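/- Let $T_1<T_2$ be real, let $p,q,m,n\in C[T_1,T_2]$ with $p>0$ and $q\ge 0$ on $[T_1,T_2]$, $m\not\equiv 0$ and $n\not\equiv 0$, and put $Lu=-(p\,u')'+q\,u$, $u^{\pm}=\max\{\pm u,0\}$. For an integer $k\ge 1$ let $C_k^{>}$ (resp. $C_k^{<}$) be the set of all $(a,b)\in\mathbb R^2$ such that the problem $$Lu=a\,m(t)\,u^{+}-b\,n(t)\,u^{-}\ \text{ in } ]T_1,T_2[,\qquad u'(T_1)=0=u'(T_2)$$ has a solution $u$ with exactly $k$ zeros in $]T_1,T_2[$ and $u(T_2)>0$ (resp. $u(T_2)<0$). A principal eigenvalue for a weight $w\in C[T_1,T_2]$ is a real $\lambda$ such that $Lu=\lambda w(t)u$ in $]T_1,T_2[$, $u'(T_1)=0=u'(T_2)$, has a solution that is positive in $]T_1,T_2[$. If $w^{+}\not\equiv0$, $\lambda_1^{w}$ denotes the largest principal eigenvalue $\ge 0$; if $w^{-}\not\equiv0$, $\lambda_{-1}^{w}$ denotes the smallest principal eigenvalue $\le 0$. Write $\mathbb R_+=[0,\infty[$ and $\mathbb R_-=]-\infty,0]$.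 Let $k\ge1$ and let $C$ be $C_k^{>}$ or $C_k^{<}$. Then the following hold; in each case the eigenvalues that occur exist. (i) If $C\cap(\mathbb R_+\times\mathbb R_+)\neq\emptyset$, there are $\alpha\ge\lambda_1^m$, $\beta\ge\lambda_1^n$ and a strictly decreasing $C^1$-diffeomorphism $f$ from $]\alpha,+\infty[$ onto $]\beta,+\infty[$ with $C\cap(\mathbb R_+\times\mathbb R_+)=\{(a,f(a)) : a>\alpha\}$. (ii) If $C\cap(\mathbb R_-\times\mathbb R_-)\neq\emptyset$, there are $\alpha\le\lambda_{-1}^m$, $\beta\le\lambda_{-1}^n$ and a strictly decreasing $C^1$-diffeomorphism $f$ from $]-\infty,\alpha[$ onto $]-\infty,\beta[$ with $C\cap(\mathbb R_-\times\mathbb R_-)=\{(a,f(a)) : a<\alpha\}$. (iii) If $C\cap(\mathbb R_-\times\mathbb R_+)\neq\emptyset$, there are $\alpha\le\lambda_{-1}^m$, $\beta\ge\lambda_1^n$ and a strictly increasing $C^1$-diffeomorphism $f$ from $]-\infty,\alpha[$ onto $]\beta,+\infty[$ with $C\cap(\mathbb R_-\times\mathbb R_+)=\{(a,f(a)) : a<\alpha\}$.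 (iv) If $C\cap(\mathbb R_+\times\mathbb R_-)\neq\emptyset$, there are $\alpha\ge\lambda_1^m$, $\beta\le\lambda_{-1}^n$ and a strictly increasing $C^1$-diffeomorphism $f$ from $]\alpha,+\infty[$ onto $]-\infty,\beta[$ with $C\cap(\mathbb R_+\times\mathbb R_-)=\{(a,f(a)) : a>\alpha\}$. -/

import Mathlib

namespace Fucik

/-- `u` is a classical solution of the Neumann problem
`-(p u')' + q u = g` in `]T₁, T₂[`, `u'(T₁) = 0 = u'(T₂)`:
`u` is of class `C¹` on `[T₁, T₂]` (with one-sided derivatives `u'` at the end points), and `p u'`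
is differentiable in `]T₁, T₂[`. The right-hand side `g` may involve `u`. -/
def IsNeumannSolution (T₁ T₂ : ℝ) (p q g u : ℝ → ℝ) : Prop :=
  ∃ u' : ℝ → ℝ,
    ContinuousOn u' (Set.Icc T₁ T₂) ∧
    (∀ t ∈ Set.Icc T₁ T₂, HasDerivWithinAt u (u' t) (Set.Icc T₁ T₂) t) ∧
    (∀ t ∈ Set.Ioo T₁ T₂, HasDerivAt (fun s => p s * u' s) (q t * u t - g t) t) ∧
    u' T₁ = 0 ∧ u' T₂ = 0

/-- `u` solves `L u = a m u⁺ - b n u⁻` in `]T₁, T₂[`, `u'(T₁) = 0 = u'(T₂)`, where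
`L u = -(p u')' + q u` and `u⁺ = max u 0`, `u⁻ = max (-u) 0`. -/
def IsFucikSolution (T₁ T₂ : ℝ) (p q m n : ℝ → ℝ) (a b : ℝ) (u : ℝ → ℝ) : Prop :=
  IsNeumannSolution T₁ T₂ p q
    (fun t => a * m t * max (u t) 0 - b * n t * max (-u t) 0) u

/-- The set `C_k^>`: those `(a, b)` for which the problem has a solution with exactly `k` zeros in
`]T₁, T₂[` and ending positively (such a solution is automatically nontrivial). -/
def CGt (T₁ T₂ : ℝ) (p q m n : ℝ → ℝ) (k : ℕ) : Set (ℝ × ℝ) :=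
  {ab | ∃ u : ℝ → ℝ, IsFucikSolution T₁ T₂ p q m n ab.1 ab.2 u ∧
    {t | t ∈ Set.Ioo T₁ T₂ ∧ u t = 0}.encard = k ∧ 0 < u T₂}

/-- The set `C_k^<`: those `(a, b)` for which the problem has a solution with exactly `k` zeros in
`]T₁, T₂[` and ending negatively. -/
def CLt (T₁ T₂ : ℝ) (p q m n : ℝ → ℝ) (k : ℕ) : Set (ℝ × ℝ) :=
  {ab | ∃ u : ℝ → ℝ, IsFucikSolution T₁ T₂ p q m n ab.1 ab.2 u ∧
    {t | t ∈ Set.Ioo T₁ T₂ ∧ u t = 0}.encard = k ∧ u T₂ < 0}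

/-- `l` is a principal eigenvalue of `L u = l m u` in `]T₁, T₂[`, `u'(T₁) = 0 = u'(T₂)`: it has an
eigenfunction that is positive in `]T₁, T₂[`. -/
def IsPrincipalEigenvalue (T₁ T₂ : ℝ) (p q m : ℝ → ℝ) (l : ℝ) : Prop :=
  ∃ u : ℝ → ℝ, IsNeumannSolution T₁ T₂ p q (fun t => l * m t * u t) u ∧
    ∀ t ∈ Set.Ioo T₁ T₂, 0 < u t

/-- `l = λ₁^m`, the principal nonnegative eigenvalue, defined when `m⁺ ≢ 0`. If `q ≡ 0` then `0` is
always a principal eigenvalue, and when there is also a positive one, `λ₁^m` is the positive one;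
hence "greatest". -/
def IsLambdaOne (T₁ T₂ : ℝ) (p q m : ℝ → ℝ) (l : ℝ) : Prop :=
  (∃ t ∈ Set.Icc T₁ T₂, 0 < m t) ∧
    IsGreatest {x | 0 ≤ x ∧ IsPrincipalEigenvalue T₁ T₂ p q m x} l

/-- `l = λ₋₁^m`, the principal nonpositive eigenvalue, defined when `m⁻ ≢ 0`. -/
def IsLambdaNegOne (T₁ T₂ : ℝ) (p q m : ℝ → ℝ) (l : ℝ) : Prop :=
  (∃ t ∈ Set.Icc T₁ T₂, m t < 0) ∧
    IsLeast {x | x ≤ 0 ∧ IsPrincipalEigenvalue T₁ T₂ p q m x} l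

/-- `f` restricts to a `C¹`-diffeomorphism from `S` onto `T` (used for open intervals). -/
def IsC1Diffeo (f : ℝ → ℝ) (S T : Set ℝ) : Prop :=
  Set.MapsTo f S T ∧ ContDiffOn ℝ 1 f S ∧
    ∃ g : ℝ → ℝ, Set.MapsTo g T S ∧ ContDiffOn ℝ 1 g T ∧ Set.InvOn g f S T

end Fucik

/-! ### Level sets of a function of two parameters that are crossed upwards. -/

namespace Fucik
open Set Filter Topology

/-! Write `u = r sin θ`, `p u' = r cos θ`. The angle then satisfies the scalar equation `θ' = w cos²
θ + A (sin⁺ θ)² + B (sin⁻ θ)²` with `w = 1/p`, `A = a m - q`, `B = b n - q`. Since `θ' = w > 0` at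
multiples of `π`, these are crossed only upwards. A nontrivial Neumann solution therefore starts at
`θ₀ = ±π/2`, and it has exactly `k` zeros iff its final angle is `θ₀ + kπ`; the final sign and `k`
determine `θ₀`. So `C` is a level set of the final angle `G(a, b)` (`Coeffs.cGt_eq`,
`Coeffs.cLt_eq`).

Variation of constants gives `G y - G x = (y.1 - x.1) M + (y.2 - x.2) N` with continuous `M`, `N`.
On the diagonal, `a M` is a positive multiple of `∫ a m (u⁺)²`. At a point of `C` this equals the
energy `∫ p u'² + q u²` of the positive humps and is positive. Hence `G` increases through the level
in `a` when `a > 0`, and likewise in `b` when `b > 0`. On the axes `G` lies below the level, because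
`π/2` is an upper barrier for the angle when `a = 0`. These facts form `UpwardLevel`; by
monotonicity and the intermediate value theorem they make the level set a decreasing `C¹` graph over
an open ray (`UpwardLevel.exists_diffeo`).

The principal eigenvalues of `m` are the zeros of `H - π/2`, where `H(a)` is the final angle of the
linear problem with weight `a m` started at `π/2`. Comparison along a positive hump gives `H(a) >
π/2` for every `a > α`, while `H(0) ≤ π/2`; so a greatest nonnegative zero exists and is at most
`α`. The weight `n` follows by replacing `u` with `-u`, and the other quadrants by changing the
signs of the weights. -/

theorem lt_of_hasDerivAt_pos_of_eq {g g' : ℝ → ℝ} {l a b : ℝ} (hab : a < b)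
    (hg : ∀ x, HasDerivAt g (g' x) x) (h : ∀ x ∈ Icc a b, g x = l → 0 < g' x)
    (ha : l ≤ g a) : l < g b := by
  have key : ∀ x ∈ Icc a b, l ≤ g x := fun x hx =>
    image_le_of_deriv_right_lt_deriv_boundary (f := fun _ => l) (f' := fun _ => 0)
      continuousOn_const (fun x _ => (hasDerivAt_const x l).hasDerivWithinAt) ha hg
      (fun x hx hx' => h x ⟨hx.1, hx.2.le⟩ hx'.symm) hx
  -- Equality at `b` is impossible: a positive derivative there would put `g` below `l` just to the
  -- left of `b`.
  refine lt_of_le_of_ne (key b ⟨hab.le, le_rfl⟩) fun hb => ?_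
  have hpos := h b ⟨hab.le, le_rfl⟩ hb.symm
  have hs := ((hasDerivAt_iff_tendsto_slope.1 (hg b)).mono_left
    (nhdsWithin_mono b (s := Iio b) (fun x (hx : x < b) => hx.ne))).eventually
    (lt_mem_nhds hpos)
  have hm : ∀ᶠ x in 𝓝[<] b, x ∈ Ioo a b := Ioo_mem_nhdsLT hab
  obtain ⟨x, hx, hxm⟩ := (hs.and hm).exists
  have h1 := key x ⟨hxm.1.le, hxm.2.le⟩
  rw [slope_def_field, ← hb] at hx
  have h2 : (g x - l) / (x - b) ≤ 0 :=
    div_nonpos_of_nonneg_of_nonpos (by linarith) (by linarith [hxm.2])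
  have h3 : (g x - l) / (x - b) = (l - g x) / (b - x) := by
    rw [← neg_sub l, ← neg_sub b, neg_div_neg_eq]
  linarith

/-- The level set `{G = l}` is crossed upwards in both variables in the open first quadrant, and
`G < l` on the axes. The functions `M`, `N` are difference quotients of `G`. -/
structure UpwardLevel (G : ℝ × ℝ → ℝ) (M N : ℝ × ℝ → ℝ × ℝ → ℝ) (l : ℝ) : Prop where
  contM : Continuous fun z : (ℝ × ℝ) × (ℝ × ℝ) => M z.1 z.2
  contN : Continuous fun z : (ℝ × ℝ) × (ℝ × ℝ) => N z.1 z.2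
  diff : ∀ x y, G y - G x = (y.1 - x.1) * M x y + (y.2 - x.2) * N x y
  posM : ∀ x, G x = l → 0 < x.1 → 0 < x.2 → 0 < M x x
  posN : ∀ x, G x = l → 0 < x.1 → 0 < x.2 → 0 < N x x
  axis_fst : ∀ a, G (a, 0) < l
  axis_snd : ∀ b, G (0, b) < l

namespace UpwardLevel

variable {G : ℝ × ℝ → ℝ} {M N : ℝ × ℝ → ℝ × ℝ → ℝ} {l : ℝ}

theorem swap (h : UpwardLevel G M N l) :
    UpwardLevel (fun x => G x.swap) (fun x y => N x.swap y.swap) (fun x y => M x.swap y.swap) l where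
  contM := h.contN.comp (f := fun z : (ℝ × ℝ) × (ℝ × ℝ) => (z.1.swap, z.2.swap)) (by fun_prop)
  contN := h.contM.comp (f := fun z : (ℝ × ℝ) × (ℝ × ℝ) => (z.1.swap, z.2.swap)) (by fun_prop)
  diff x y := by rw [h.diff]; simp only [Prod.fst_swap, Prod.snd_swap]; ring
  posM x hx h1 h2 := h.posN _ hx h2 h1
  posN x hx h1 h2 := h.posM _ hx h2 h1
  axis_fst a := h.axis_snd a
  axis_snd a := h.axis_fst a

theorem continuous (h : UpwardLevel G M N l) : Continuous G := by
  have e : G = fun y => G 0 + (y.1 * M 0 y + y.2 * N 0 y) := by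
    funext y
    have := h.diff 0 y
    simp only [Prod.fst_zero, Prod.snd_zero, sub_zero] at this
    linarith
  have h1 : Continuous fun y => M 0 y :=
    h.contM.comp (f := fun y : ℝ × ℝ => ((0 : ℝ × ℝ), y)) (by fun_prop)
  have h2 : Continuous fun y => N 0 y :=
    h.contN.comp (f := fun y : ℝ × ℝ => ((0 : ℝ × ℝ), y)) (by fun_prop)
  rw [e]
  fun_prop

/-- With the second coordinate fixed, the difference quotient of `G` is exactly `M`, so its limit is
the diagonal value of `M`. -/
theorem hasDerivAt_fst (h : UpwardLevel G M N l) (a b : ℝ) :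
    HasDerivAt (fun x => G (x, b)) (M (a, b) (a, b)) a := by
  rw [hasDerivAt_iff_tendsto_slope]
  have h1 : Continuous fun x => M (a, b) (x, b) :=
    h.contM.comp (f := fun x : ℝ => ((a, b), (x, b))) (by fun_prop)
  refine ((h1.tendsto a).mono_left nhdsWithin_le_nhds).congr' ?_
  filter_upwards [self_mem_nhdsWithin] with x hx
  have := h.diff (a, b) (x, b)
  have hx' : x - a ≠ 0 := sub_ne_zero.2 hx
  rw [slope_def_field, this]
  field_simp
  simp

theorem pos_of_nonneg (h : UpwardLevel G M N l) {x : ℝ × ℝ} (hx : G x = l) (h1 : 0 ≤ x.1)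
    (h2 : 0 ≤ x.2) : 0 < x.1 ∧ 0 < x.2 := by
  obtain ⟨a, b⟩ := x
  refine ⟨lt_of_le_of_ne h1 ?_, lt_of_le_of_ne h2 ?_⟩
  · rintro rfl
    exact (h.axis_snd b).ne hx
  · rintro rfl
    exact (h.axis_fst a).ne hx

theorem lt_of_lt_fst (h : UpwardLevel G M N l) {a a' b : ℝ} (ha : 0 < a) (hb : 0 < b)
    (haa : a < a') (hG : l ≤ G (a, b)) : l < G (a', b) :=
  lt_of_hasDerivAt_pos_of_eq (g := fun x => G (x, b)) haa (fun x => h.hasDerivAt_fst x b)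
    (fun x hx hx' => h.posM (x, b) hx' (ha.trans_le hx.1) hb) hG

theorem fst_inj (h : UpwardLevel G M N l) {a a' b : ℝ} (ha : 0 < a) (ha' : 0 < a') (hb : 0 < b)
    (hG : G (a, b) = l) (hG' : G (a', b) = l) : a = a' := by
  rcases lt_trichotomy a a' with hlt | rfl | hlt
  · exact absurd hG' (h.lt_of_lt_fst ha hb hlt hG.ge).ne'
  · rfl
  · exact absurd hG (h.lt_of_lt_fst ha' hb hlt hG'.ge).ne'

theorem exists_of_lt (h : UpwardLevel G M N l) {a b : ℝ} (hb : 0 < b) (hG : l < G (a, b)) :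
    ∃ b', 0 < b' ∧ b' < b ∧ G (a, b') = l := by
  have hc : Continuous fun y => G (a, y) := h.continuous.comp (f := fun y => (a, y)) (by fun_prop)
  obtain ⟨b', hb', e⟩ := intermediate_value_Icc hb.le hc.continuousOn ⟨(h.axis_fst a).le, hG.le⟩
  simp only at e
  refine ⟨b', lt_of_le_of_ne hb'.1 ?_, lt_of_le_of_ne hb'.2 ?_, e⟩
  · rintro rfl
    exact (h.axis_fst a).ne e
  · rintro rfl
    exact hG.ne' e

/-- The points of the level set in the open first quadrant. -/
def Rel (G : ℝ × ℝ → ℝ) (l a b : ℝ) : Prop := 0 < a ∧ 0 < b ∧ G (a, b) = l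

theorem rel_step (h : UpwardLevel G M N l) {a a' b : ℝ} (hr : Rel G l a b) (haa : a < a') :
    ∃ b', Rel G l a' b' ∧ b' < b := by
  obtain ⟨b', h1, h2, h3⟩ := h.exists_of_lt hr.2.1 (h.lt_of_lt_fst hr.1 hr.2.1 haa hr.2.2.ge)
  exact ⟨b', ⟨hr.1.trans haa, h1, h3⟩, h2⟩

/-- Raising `b` lifts `G` strictly above the level. This is an open condition, so it survives a
small decrease of `a`; lowering `b` towards the axis then returns to the level. -/
theorem rel_left (h : UpwardLevel G M N l) {a b : ℝ} (hr : Rel G l a b) :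
    ∃ a' b', Rel G l a' b' ∧ a' < a := by
  have h1 : l < G (a, b + 1) :=
    h.swap.lt_of_lt_fst (a := b) (b := a) hr.2.1 hr.1 (lt_add_one b) hr.2.2.ge
  have hc : Continuous fun x => G (x, b + 1) :=
    h.continuous.comp (f := fun y => (y, b + 1)) (by fun_prop)
  have h2 : ∀ᶠ x in 𝓝[<] a, l < G (x, b + 1) :=
    ((hc.tendsto a).mono_left nhdsWithin_le_nhds).eventually (lt_mem_nhds h1)
  have h3 : ∀ᶠ x in 𝓝[<] a, x ∈ Ioo 0 a := Ioo_mem_nhdsLT hr.1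
  obtain ⟨x, hx, hx'⟩ := (h2.and h3).exists
  obtain ⟨b', p1, -, p3⟩ := h.exists_of_lt (by linarith [hr.2.1]) hx
  exact ⟨x, b', ⟨hx'.1, p1, p3⟩, hx'.2⟩

/-- The set of first coordinates is upward closed by `rel_step`, has no least element by `rel_left`
and is bounded below by `0`; hence it is an open ray. -/
theorem exists_domain (h : UpwardLevel G M N l) (hne : ∃ a b, Rel G l a b) :
    ∃ α, ∀ a, (∃ b, Rel G l a b) ↔ α < a := by
  obtain ⟨a₀, b₀, hr₀⟩ := hne
  have bdd : BddBelow {a | ∃ b, Rel G l a b} := ⟨0, by rintro a ⟨b, hr⟩; exact hr.1.le⟩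
  refine ⟨sInf {a | ∃ b, Rel G l a b}, fun a => ⟨fun ⟨b, hr⟩ => ?_, fun ha => ?_⟩⟩
  · obtain ⟨a', b', hr', hlt⟩ := h.rel_left hr
    exact (csInf_le bdd ⟨b', hr'⟩).trans_lt hlt
  · obtain ⟨a', ⟨b', hr'⟩, hlt⟩ :=
      exists_lt_of_csInf_lt (s := {a | ∃ b, Rel G l a b}) ⟨a₀, b₀, hr₀⟩ ha
    obtain ⟨b, hr, -⟩ := h.rel_step hr' hlt
    exact ⟨b, hr⟩

/-- Two points of the graph satisfy `0 = (x - a) M + (f x - f a) N`. The slope of `f` is thus `-M /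
N`, and continuity of `f` is enough to pass to the limit. -/
theorem contDiffOn_of_rel (h : UpwardLevel G M N l) {α : ℝ} {f : ℝ → ℝ}
    (hf : ∀ a ∈ Ioi α, Rel G l a (f a)) (hc : ∀ a ∈ Ioi α, ContinuousAt f a) :
    ContDiffOn ℝ 1 f (Ioi α) := by
  have hco : ContinuousOn f (Ioi α) := fun a ha => (hc a ha).continuousWithinAt
  have hd : ∀ a ∈ Ioi α, HasDerivAt f (-(M (a, f a) (a, f a) / N (a, f a) (a, f a))) a := by
    intro a ha
    have hN : 0 < N (a, f a) (a, f a) := h.posN _ (hf a ha).2.2 (hf a ha).1 (hf a ha).2.1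
    have cp : ContinuousAt (fun x => ((a, f a), (x, f x))) a :=
      continuousAt_const.prodMk (continuousAt_id.prodMk (hc a ha))
    have cM : ContinuousAt (fun x => M (a, f a) (x, f x)) a :=
      ContinuousAt.comp (f := fun x => ((a, f a), (x, f x))) h.contM.continuousAt cp
    have cN : ContinuousAt (fun x => N (a, f a) (x, f x)) a :=
      ContinuousAt.comp (f := fun x => ((a, f a), (x, f x))) h.contN.continuousAt cp
    rw [hasDerivAt_iff_tendsto_slope]
    have ct : Tendsto (fun x => -(M (a, f a) (x, f x) / N (a, f a) (x, f x))) (𝓝 a)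
        (𝓝 (-(M (a, f a) (a, f a) / N (a, f a) (a, f a)))) := (cM.div cN hN.ne').neg
    refine (ct.mono_left nhdsWithin_le_nhds).congr' ?_
    have e1 : ∀ᶠ x in 𝓝[≠] a, 0 < N (a, f a) (x, f x) :=
      (cN.tendsto.mono_left nhdsWithin_le_nhds).eventually (lt_mem_nhds hN)
    have e2 : ∀ᶠ x in 𝓝[≠] a, x ∈ Ioi α := nhdsWithin_le_nhds (Ioi_mem_nhds ha)
    filter_upwards [self_mem_nhdsWithin, e1, e2] with x hx h1 h2
    have e := h.diff (a, f a) (x, f x)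
    rw [(hf a ha).2.2, (hf x h2).2.2, sub_self] at e
    simp only at e
    have hx' : x - a ≠ 0 := sub_ne_zero.2 hx
    rw [slope_def_field, eq_div_iff hx', ← neg_div, div_mul_eq_mul_div, div_eq_iff h1.ne']
    linarith
  rw [show (1 : WithTop ℕ∞) = 0 + 1 by simp, contDiffOn_succ_iff_deriv_of_isOpen isOpen_Ioi]
  refine ⟨fun a ha => (hd a ha).differentiableAt.differentiableWithinAt, by simp, ?_⟩
  rw [contDiffOn_zero]
  have cp : ContinuousOn (fun x => ((x, f x), (x, f x))) (Ioi α) := by fun_prop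
  have cM : ContinuousOn (fun x => M (x, f x) (x, f x)) (Ioi α) :=
    h.contM.comp_continuousOn (f := fun x => ((x, f x), (x, f x))) cp
  have cN : ContinuousOn (fun x => N (x, f x) (x, f x)) (Ioi α) :=
    h.contN.comp_continuousOn (f := fun x => ((x, f x), (x, f x))) cp
  refine (cM.div cN fun a ha => ?_).neg.congr fun a ha => (hd a ha).deriv
  exact (h.posN _ (hf a ha).2.2 (hf a ha).1 (hf a ha).2.1).ne'

theorem strictAntiOn_of_rel (h : UpwardLevel G M N l) {α : ℝ} {f : ℝ → ℝ}
    (hf : ∀ a ∈ Ioi α, Rel G l a (f a)) : StrictAntiOn f (Ioi α) := by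
  intro a ha a' ha' hlt
  obtain ⟨b, hb, hb'⟩ := h.rel_step (hf a ha) hlt
  have r := hf a' ha'
  have : b = f a' := h.swap.fst_inj hb.2.1 r.2.1 r.1 hb.2.2 r.2.2
  exact this ▸ hb'

/-- A strictly monotone function whose image is an interval has no jumps. -/
theorem continuousAt_of_strictAntiOn {f : ℝ → ℝ} {α β : ℝ} (hf : StrictAntiOn f (Ioi α))
    (hi : f '' Ioi α = Ioi β) {a : ℝ} (ha : a ∈ Ioi α) : ContinuousAt f a := by
  have hb : f a ∈ Ioi β := hi ▸ mem_image_of_mem f ha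
  have hm : StrictMonoOn (fun x => -f x) (Ioi α) := fun x hx y hy hxy => neg_lt_neg (hf hx hy hxy)
  have := hm.continuousAt_of_image_mem_nhds (Ioi_mem_nhds ha) (by
    have e : (fun x => -f x) '' Ioi α = Iio (-β) := by
      rw [show (fun x => -f x) = Neg.neg ∘ f from rfl, image_comp, hi]
      simp
    rw [e]
    exact Iio_mem_nhds (neg_lt_neg hb))
  refine this.neg.congr (Eventually.of_forall fun x => ?_)
  simp

/-- The part of the level set in the first quadrant is the graph of a strictly decreasing
`C¹`-diffeomorphism between two rays. -/
theorem exists_diffeo (h : UpwardLevel G M N l)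
    (hne : ({x | G x = l} ∩ (Ici (0 : ℝ) ×ˢ Ici (0 : ℝ))).Nonempty) :
    ∃ α β : ℝ, ∃ f : ℝ → ℝ, IsC1Diffeo f (Ioi α) (Ioi β) ∧ StrictAntiOn f (Ioi α) ∧
      {x | G x = l} ∩ (Ici (0 : ℝ) ×ˢ Ici (0 : ℝ)) = (fun a => (a, f a)) '' Ioi α := by
  obtain ⟨⟨a₀, b₀⟩, hG₀, ha₀, hb₀⟩ := hne
  have hp₀ := h.pos_of_nonneg hG₀ ha₀ hb₀
  obtain ⟨α, hα⟩ := h.exists_domain ⟨a₀, b₀, hp₀.1, hp₀.2, hG₀⟩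
  obtain ⟨β, hβ⟩ := h.swap.exists_domain ⟨b₀, a₀, hp₀.2, hp₀.1, hG₀⟩
  choose! f hf using fun a (ha : α < a) => (hα a).2 ha
  choose! g hg using fun b (hb : β < b) => (hβ b).2 hb
  have mf : MapsTo f (Ioi α) (Ioi β) := fun a ha =>
    (hβ _).1 ⟨a, (hf a ha).2.1, (hf a ha).1, (hf a ha).2.2⟩
  have mg : MapsTo g (Ioi β) (Ioi α) := fun b hb =>
    (hα _).1 ⟨b, (hg b hb).2.1, (hg b hb).1, (hg b hb).2.2⟩
  have gf : ∀ a ∈ Ioi α, g (f a) = a := fun a ha =>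
    h.fst_inj (hg _ (mf ha)).2.1 (hf a ha).1 (hf a ha).2.1 (hg _ (mf ha)).2.2 (hf a ha).2.2
  have fg : ∀ b ∈ Ioi β, f (g b) = b := fun b hb =>
    h.swap.fst_inj (hf _ (mg hb)).2.1 (hg b hb).1 (hg b hb).2.1 (hf _ (mg hb)).2.2 (hg b hb).2.2
  have inv : InvOn g f (Ioi α) (Ioi β) := ⟨gf, fg⟩
  have sf := h.strictAntiOn_of_rel hf
  have sg := h.swap.strictAntiOn_of_rel hg
  have imf : f '' Ioi α = Ioi β :=
    subset_antisymm mf.image_subset fun b hb => ⟨g b, mg hb, fg b hb⟩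
  have img : g '' Ioi β = Ioi α :=
    subset_antisymm mg.image_subset fun a ha => ⟨f a, mf ha, gf a ha⟩
  refine ⟨α, β, f, ⟨mf, h.contDiffOn_of_rel hf fun a ha => continuousAt_of_strictAntiOn sf imf ha,
    g, mg, h.swap.contDiffOn_of_rel hg fun a ha => continuousAt_of_strictAntiOn sg img ha, inv⟩,
    sf, ?_⟩
  ext ⟨a, b⟩
  constructor
  · rintro ⟨hG, ha, hb⟩
    have hp := h.pos_of_nonneg hG ha hb
    have haα : α < a := (hα a).1 ⟨b, hp.1, hp.2, hG⟩
    have r := hf a haα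
    have : f a = b := h.swap.fst_inj r.2.1 hp.2 hp.1 r.2.2 hG
    exact ⟨a, haα, Prod.ext rfl this⟩
  · rintro ⟨a', ha', e⟩
    simp only [Prod.mk.injEq] at e
    obtain ⟨rfl, rfl⟩ := e
    have r := hf a' ha'
    exact ⟨r.2.2, r.1.le, r.2.1.le⟩

end UpwardLevel
end Fucik

/-! ### The Prüfer angle equation: mean slopes, comparison, existence. -/

namespace Fucik
open Set Filter Topology Real

theorem hasDerivAt_max_zero_sq (y : ℝ) :
    HasDerivAt (fun x : ℝ => max x 0 ^ 2) (2 * max y 0) y := by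
  rcases lt_trichotomy y 0 with h | rfl | h
  · rw [max_eq_right h.le, mul_zero]
    refine (hasDerivAt_const y (0 : ℝ)).congr_of_eventuallyEq ?_
    filter_upwards [Iio_mem_nhds h] with x hx
    rw [max_eq_right (le_of_lt hx)]
    norm_num
  · rw [max_self, mul_zero, hasDerivAt_iff_isLittleO]
    have h1 : (fun x : ℝ => max x 0 ^ 2) =O[𝓝 0] fun x => x ^ 2 := by
      refine Asymptotics.IsBigO.of_bound 1 (Eventually.of_forall fun x => ?_)
      rw [one_mul, Real.norm_eq_abs, Real.norm_eq_abs, abs_of_nonneg (sq_nonneg _),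
        abs_of_nonneg (sq_nonneg _)]
      rcases le_total x 0 with hx | hx
      · rw [max_eq_right hx]
        nlinarith
      · rw [max_eq_left hx]
    have h2 : (fun x : ℝ => x ^ 2) =o[𝓝 0] fun x => x := by
      simpa using Asymptotics.isLittleO_pow_pow (𝕜 := ℝ) (m := 1) (n := 2) (by norm_num)
    simpa using h1.trans_isLittleO h2
  · rw [max_eq_left h.le]
    have h1 : HasDerivAt (fun x : ℝ => x ^ 2) (2 * y) y := by simpa using hasDerivAt_pow 2 y
    refine h1.congr_of_eventuallyEq ?_
    filter_upwards [Ioi_mem_nhds h] with x hx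
    rw [max_eq_left (le_of_lt hx)]

/-- The right-hand side of the Prüfer angle equation for `-(u' / w)' = A u⁺ - B u⁻`, where
`u = r sin θ` and `u' / w = r cos θ`. -/
noncomputable def angleRhs (w A B : ℝ → ℝ) (t x : ℝ) : ℝ :=
  w t * cos x ^ 2 + A t * max (sin x) 0 ^ 2 + B t * max (-sin x) 0 ^ 2

/-- The derivative of `angleRhs` with respect to the angle. -/
noncomputable def angleRhsDeriv (w A B : ℝ → ℝ) (t x : ℝ) : ℝ :=
  2 * cos x * (-w t * sin x + A t * max (sin x) 0 - B t * max (-sin x) 0)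

theorem hasDerivAt_angleRhs (w A B : ℝ → ℝ) (t x : ℝ) :
    HasDerivAt (angleRhs w A B t) (angleRhsDeriv w A B t x) x := by
  have h1 : HasDerivAt (fun x => cos x ^ 2) (2 * cos x * -sin x) x := by
    simpa using! (hasDerivAt_cos x).pow 2
  have h2 := (hasDerivAt_max_zero_sq (sin x)).comp x (hasDerivAt_sin x)
  have h3 := (hasDerivAt_max_zero_sq (-sin x)).comp x (hasDerivAt_sin x).neg
  convert! ((h1.const_mul (w t)).add (h2.const_mul (A t))).add (h3.const_mul (B t)) using 1
  rw [angleRhsDeriv]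
  ring

/-- The mean slope of `angleRhs` between two angles. -/
noncomputable def angleSlope (w A B : ℝ → ℝ) (t x y : ℝ) : ℝ :=
  ∫ s in (0 : ℝ)..1, angleRhsDeriv w A B t (x + s * (y - x))

theorem angleSlope_self (w A B : ℝ → ℝ) (t x : ℝ) :
    angleSlope w A B t x x = angleRhsDeriv w A B t x := by
  simp [angleSlope]

theorem angleRhs_sub (w A B : ℝ → ℝ) (t x y : ℝ) :
    angleRhs w A B t y - angleRhs w A B t x = angleSlope w A B t x y * (y - x) := by
  have hd : ∀ s ∈ uIcc (0 : ℝ) 1, HasDerivAt (fun s => angleRhs w A B t (x + s * (y - x)))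
      (angleRhsDeriv w A B t (x + s * (y - x)) * (y - x)) s := fun s _ => by
    have h1 : HasDerivAt (fun s : ℝ => x + s * (y - x)) (y - x) s := by
      simpa using ((hasDerivAt_id s).mul_const (y - x)).const_add x
    exact (hasDerivAt_angleRhs w A B t _).comp s h1
  have hc : Continuous fun s : ℝ => angleRhsDeriv w A B t (x + s * (y - x)) * (y - x) := by
    unfold angleRhsDeriv
    fun_prop
  have := intervalIntegral.integral_eq_sub_of_hasDerivAt hd (hc.intervalIntegrable 0 1)
  rw [intervalIntegral.integral_mul_const] at this
  simp only [one_mul, zero_mul, add_zero, add_sub_cancel] at this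
  rw [angleSlope, this]

theorem abs_angleRhsDeriv_le (w A B : ℝ → ℝ) (t x : ℝ) :
    |angleRhsDeriv w A B t x| ≤ 2 * (|w t| + |A t| + |B t|) := by
  have hs := abs_sin_le_one x
  have hm : |max (sin x) 0| ≤ 1 := by
    rw [abs_of_nonneg (le_max_right _ _)]
    exact max_le (sin_le_one x) zero_le_one
  have hn : |max (-sin x) 0| ≤ 1 := by
    rw [abs_of_nonneg (le_max_right _ _)]
    exact max_le (by linarith [neg_one_le_sin x]) zero_le_one
  rw [angleRhsDeriv, abs_mul, abs_mul, abs_two]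
  have h1 : |(-w t * sin x + A t * max (sin x) 0 - B t * max (-sin x) 0)| ≤
      |w t| + |A t| + |B t| := by
    refine (abs_sub _ _).trans (add_le_add ((abs_add_le _ _).trans (add_le_add ?_ ?_)) ?_) <;>
      rw [abs_mul]
    · rw [abs_neg]
      exact mul_le_of_le_one_right (abs_nonneg _) hs
    · exact mul_le_of_le_one_right (abs_nonneg _) hm
    · exact mul_le_of_le_one_right (abs_nonneg _) hn
  calc 2 * |cos x| * _ ≤ 2 * 1 * (|w t| + |A t| + |B t|) := by
        gcongr
        exact abs_cos_le_one x
    _ = _ := by ring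

theorem abs_angleSlope_le (w A B : ℝ → ℝ) (t x y : ℝ) :
    |angleSlope w A B t x y| ≤ 2 * (|w t| + |A t| + |B t|) := by
  have := intervalIntegral.norm_integral_le_of_norm_le_const
    (f := fun s => angleRhsDeriv w A B t (x + s * (y - x))) (a := 0) (b := 1)
    (C := 2 * (|w t| + |A t| + |B t|)) (fun s _ => abs_angleRhsDeriv_le w A B t _)
  simpa [angleSlope] using this

theorem abs_angleRhs_le (w A B : ℝ → ℝ) (t x : ℝ) :
    |angleRhs w A B t x| ≤ |w t| + |A t| + |B t| := by
  have hc : |cos x ^ 2| ≤ 1 := by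
    rw [abs_of_nonneg (sq_nonneg _)]
    exact cos_sq_le_one x
  have hm : |max (sin x) 0 ^ 2| ≤ 1 := by
    rw [abs_of_nonneg (sq_nonneg _)]
    exact pow_le_one₀ (le_max_right _ _) (max_le (sin_le_one x) zero_le_one)
  have hn : |max (-sin x) 0 ^ 2| ≤ 1 := by
    rw [abs_of_nonneg (sq_nonneg _)]
    exact pow_le_one₀ (le_max_right _ _) (max_le (by linarith [neg_one_le_sin x]) zero_le_one)
  refine (abs_add_le _ _).trans (add_le_add ((abs_add_le _ _).trans (add_le_add ?_ ?_)) ?_) <;>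
    rw [abs_mul] <;> exact mul_le_of_le_one_right (abs_nonneg _) (by assumption)

theorem continuous_angleRhs {X : Type*} [TopologicalSpace X] {w A B x : X → ℝ}
    (hw : Continuous w) (hA : Continuous A) (hB : Continuous B) (hx : Continuous x) :
    Continuous fun z => angleRhs (fun _ => w z) (fun _ => A z) (fun _ => B z) 0 (x z) := by
  unfold angleRhs
  fun_prop

theorem continuous_angleSlope {X : Type*} [TopologicalSpace X] {w A B x y : X → ℝ}
    (hw : Continuous w) (hA : Continuous A) (hB : Continuous B) (hx : Continuous x)
    (hy : Continuous y) :
    Continuous fun z =>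
      angleSlope (fun _ => w z) (fun _ => A z) (fun _ => B z) 0 (x z) (y z) := by
  unfold angleSlope angleRhsDeriv
  apply intervalIntegral.continuous_parametric_intervalIntegral_of_continuous'
  simp only [Function.uncurry_def]
  fun_prop

/-- Variation of constants for a scalar linear equation. -/
theorem integral_eq_of_linear_ode {δ κ g : ℝ → ℝ} {s e : ℝ} (hse : s ≤ e) (hδ : Continuous δ)
    (hκ : Continuous κ) (hg : Continuous g)
    (hd : ∀ t ∈ Ioo s e, HasDerivAt δ (κ t * δ t + g t) t) :
    ∫ t in s..e, exp (-∫ τ in s..t, κ τ) * g t = exp (-∫ τ in s..e, κ τ) * δ e - δ s := by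
  have hK : ∀ t, HasDerivAt (fun t => ∫ τ in s..t, κ τ) (κ t) t := fun t =>
    intervalIntegral.integral_hasDerivAt_right (hκ.intervalIntegrable _ _)
      hκ.aestronglyMeasurable.stronglyMeasurableAtFilter hκ.continuousAt
  have hKc : Continuous fun t => ∫ τ in s..t, κ τ :=
    continuous_iff_continuousAt.2 fun t => (hK t).continuousAt
  have hc : Continuous fun t => exp (-∫ τ in s..t, κ τ) * g t := by fun_prop
  have := intervalIntegral.integral_eq_sub_of_hasDerivAt_of_le hse
    (f := fun t => exp (-∫ τ in s..t, κ τ) * δ t) (f' := fun t => exp (-∫ τ in s..t, κ τ) * g t)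
    (by fun_prop) (fun t ht => by
      convert! (hK t).neg.exp.mul (hd t ht) using 1
      simp only [Pi.neg_apply]
      ring) (hc.intervalIntegrable _ _)
  simpa using this

variable {w A B : ℝ → ℝ}

theorem continuous_angleSlope_along (hw : Continuous w) (hA : Continuous A) (hB : Continuous B)
    {θ₁ θ₂ : ℝ → ℝ} (h₁ : Continuous θ₁) (h₂ : Continuous θ₂) :
    Continuous fun t => angleSlope w A B t (θ₁ t) (θ₂ t) :=
  continuous_angleSlope hw hA hB h₁ h₂

/-- The difference of two perturbed solutions of the angle equation. -/
theorem angle_diff (hw : Continuous w) (hA : Continuous A) (hB : Continuous B)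
    {θ₁ θ₂ g₁ g₂ : ℝ → ℝ} {s e : ℝ} (hse : s ≤ e) (h₁ : Continuous θ₁) (h₂ : Continuous θ₂)
    (hg₁ : Continuous g₁) (hg₂ : Continuous g₂)
    (hd₁ : ∀ t ∈ Ioo s e, HasDerivAt θ₁ (angleRhs w A B t (θ₁ t) + g₁ t) t)
    (hd₂ : ∀ t ∈ Ioo s e, HasDerivAt θ₂ (angleRhs w A B t (θ₂ t) + g₂ t) t) :
    ∫ t in s..e, exp (-∫ τ in s..t, angleSlope w A B τ (θ₁ τ) (θ₂ τ)) * (g₂ t - g₁ t) =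
      exp (-∫ τ in s..e, angleSlope w A B τ (θ₁ τ) (θ₂ τ)) * (θ₂ e - θ₁ e) - (θ₂ s - θ₁ s) := by
  refine integral_eq_of_linear_ode (δ := fun t => θ₂ t - θ₁ t) hse (h₂.sub h₁)
    (continuous_angleSlope_along hw hA hB h₁ h₂) (hg₂.sub hg₁) fun t ht => ?_
  convert! (hd₂ t ht).sub (hd₁ t ht) using 1
  linear_combination -angleRhs_sub w A B t (θ₁ t) (θ₂ t)

/-- The perturbations are the defects of sub- and supersolutions. The difference `θ₂ - θ₁` solves a
linear equation with source `g₂ - g₁ ≥ 0`, so variation of constants preserves its sign. -/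
theorem angle_compare (hw : Continuous w) (hA : Continuous A) (hB : Continuous B)
    {θ₁ θ₂ g₁ g₂ : ℝ → ℝ} {s e : ℝ} (hse : s ≤ e) (h₁ : Continuous θ₁) (h₂ : Continuous θ₂)
    (hg₁ : Continuous g₁) (hg₂ : Continuous g₂)
    (hd₁ : ∀ t ∈ Ioo s e, HasDerivAt θ₁ (angleRhs w A B t (θ₁ t) + g₁ t) t)
    (hd₂ : ∀ t ∈ Ioo s e, HasDerivAt θ₂ (angleRhs w A B t (θ₂ t) + g₂ t) t)
    (hg : ∀ t ∈ Icc s e, g₁ t ≤ g₂ t) :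
    (θ₁ s ≤ θ₂ s → θ₁ e ≤ θ₂ e) ∧ (θ₁ s < θ₂ s → θ₁ e < θ₂ e) := by
  have h := angle_diff hw hA hB hse h₁ h₂ hg₁ hg₂ hd₁ hd₂
  have hI : 0 ≤ ∫ t in s..e, exp (-∫ τ in s..t, angleSlope w A B τ (θ₁ τ) (θ₂ τ)) *
      (g₂ t - g₁ t) :=
    intervalIntegral.integral_nonneg hse fun t ht =>
      mul_nonneg (exp_pos _).le (sub_nonneg.2 (hg t ht))
  have hE := exp_pos (-∫ τ in s..e, angleSlope w A B τ (θ₁ τ) (θ₂ τ))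
  constructor <;> intro hs
  · exact sub_nonneg.1 (nonneg_of_mul_nonneg_right (by linarith) hE)
  · exact sub_pos.1 (pos_of_mul_pos_right (a := exp _) (by linarith) hE.le)

theorem angle_compare_strict (hw : Continuous w) (hA : Continuous A) (hB : Continuous B)
    {θ₁ θ₂ g₁ g₂ : ℝ → ℝ} {s e : ℝ} (hse : s < e) (h₁ : Continuous θ₁) (h₂ : Continuous θ₂)
    (hg₁ : Continuous g₁) (hg₂ : Continuous g₂)
    (hd₁ : ∀ t ∈ Ioo s e, HasDerivAt θ₁ (angleRhs w A B t (θ₁ t) + g₁ t) t)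
    (hd₂ : ∀ t ∈ Ioo s e, HasDerivAt θ₂ (angleRhs w A B t (θ₂ t) + g₂ t) t)
    (hg : ∀ t ∈ Icc s e, g₁ t < g₂ t) (hs : θ₁ s ≤ θ₂ s) : θ₁ e < θ₂ e := by
  have h := angle_diff hw hA hB hse.le h₁ h₂ hg₁ hg₂ hd₁ hd₂
  have hκ := continuous_angleSlope_along hw hA hB h₁ h₂
  have hKc : Continuous fun t => ∫ τ in s..t, angleSlope w A B τ (θ₁ τ) (θ₂ τ) :=
    intervalIntegral.continuous_primitive (fun _ _ => hκ.intervalIntegrable _ _) s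
  have hI : 0 < ∫ t in s..e, exp (-∫ τ in s..t, angleSlope w A B τ (θ₁ τ) (θ₂ τ)) *
      (g₂ t - g₁ t) :=
    intervalIntegral.intervalIntegral_pos_of_pos_on
      (Continuous.intervalIntegrable (by fun_prop) _ _)
      (fun t ht => mul_pos (exp_pos _) (sub_pos.2 (hg t (Ioo_subset_Icc_self ht)))) hse
  have hE := exp_pos (-∫ τ in s..e, angleSlope w A B τ (θ₁ τ) (θ₂ τ))
  exact sub_pos.1 (pos_of_mul_pos_right (a := exp _) (by linarith) hE.le)

/-- `θ` is a continuous function that solves the angle equation in `]T₁, T₂[`. -/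
def IsAngle (T₁ T₂ : ℝ) (w A B θ : ℝ → ℝ) : Prop :=
  Continuous θ ∧ ∀ t ∈ Ioo T₁ T₂, HasDerivAt θ (angleRhs w A B t (θ t)) t

/-- On `[T₁, T₂]` the right-hand side is bounded and globally Lipschitz in the angle, so the
Picard-Lindelöf solution covers the whole interval. It is extended by constants, which makes
estimates on `[T₁, T₂]` valid for all times. -/
theorem exists_isAngle {T₁ T₂ : ℝ} (hT : T₁ < T₂) (hw : Continuous w) (hA : Continuous A)
    (hB : Continuous B) (θ₀ : ℝ) :
    ∃ θ, IsAngle T₁ T₂ w A B θ ∧ θ T₁ = θ₀ ∧ ∀ t, θ (projIcc T₁ T₂ hT.le t) = θ t := by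
  have hb : Continuous fun t => |w t| + |A t| + |B t| := by fun_prop
  obtain ⟨C, hC⟩ := isCompact_Icc.exists_bound_of_continuousOn (s := Icc T₁ T₂) hb.continuousOn
  have hC' : ∀ t ∈ Icc T₁ T₂, |w t| + |A t| + |B t| ≤ C := fun t ht =>
    (le_abs_self _).trans (hC t ht)
  have hC0 : 0 ≤ C := (by positivity : 0 ≤ |w T₁| + |A T₁| + |B T₁|).trans
    (hC' T₁ ⟨le_rfl, hT.le⟩)
  have hPL : IsPicardLindelof (angleRhs w A B) (tmin := T₁) (tmax := T₂)
      ⟨T₁, le_rfl, hT.le⟩ θ₀ ⟨C * (T₂ - T₁), mul_nonneg hC0 (sub_nonneg.2 hT.le)⟩ 0 ⟨C, hC0⟩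
      ⟨2 * C, by positivity⟩ := by
    refine ⟨fun t ht => LipschitzOnWith.of_dist_le_mul fun x _ y _ => ?_, fun x _ => ?_,
      fun t ht x _ => (abs_angleRhs_le w A B t x).trans (hC' t ht), ?_⟩
    · rw [Real.dist_eq, Real.dist_eq, angleRhs_sub, abs_mul]
      refine mul_le_mul_of_nonneg_right ?_ (abs_nonneg _)
      exact (abs_angleSlope_le w A B t y x).trans
        (mul_le_mul_of_nonneg_left (hC' t ht) zero_le_two)
    · exact (continuous_angleRhs hw hA hB continuous_const).continuousOn
    · simp only [sub_self, NNReal.coe_zero, sub_zero]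
      rw [max_eq_left (sub_nonneg.2 hT.le)]
      exact le_rfl
  obtain ⟨α, hα0, hα⟩ := hPL.exists_eq_forall_mem_Icc_hasDerivWithinAt₀
  have hαc : ContinuousOn α (Icc T₁ T₂) := fun t ht => (hα t ht).continuousWithinAt
  refine ⟨IccExtend hT.le (domRestrict (Icc T₁ T₂) α), ⟨?_, fun t ht => ?_⟩, ?_, fun t => ?_⟩
  · exact (continuousOn_iff_continuous_domRestrict.1 hαc).Icc_extend'
  · have e : ∀ x ∈ Icc T₁ T₂, IccExtend hT.le (domRestrict (Icc T₁ T₂) α) x = α x := fun x hx => by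
      rw [IccExtend_of_mem _ _ hx, domRestrict_apply]
    have hn : Icc T₁ T₂ ∈ 𝓝 t := Icc_mem_nhds ht.1 ht.2
    rw [e t (Ioo_subset_Icc_self ht)]
    exact ((hα t (Ioo_subset_Icc_self ht)).hasDerivAt hn).congr_of_eventuallyEq
      (by filter_upwards [hn] with x hx using e x hx)
  · rw [IccExtend_of_mem _ _ (left_mem_Icc.2 hT.le), domRestrict_apply]
    exact hα0
  · simp [IccExtend]

end Fucik

/-! ### Barriers, zeros and energy along one angle. -/

namespace Fucik
open Set Filter Topology Real

theorem angleRhs_of_sin_eq_zero {w A B : ℝ → ℝ} {t c : ℝ} (hc : sin c = 0) :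
    angleRhs w A B t c = w t := by
  have : cos c ^ 2 = 1 := by nlinarith [sin_sq_add_cos_sq c]
  simp [angleRhs, hc, this]

theorem angleRhs_of_sin_nonneg {w A B B' : ℝ → ℝ} {t x : ℝ} (hx : 0 ≤ sin x) :
    angleRhs w A B t x = angleRhs w A B' t x := by
  simp [angleRhs, max_eq_right (neg_nonpos.2 hx)]

theorem angleRhs_add_of_neg {w A B : ℝ → ℝ} {t x c : ℝ} (hs : ∀ y, sin (y + c) = -sin y)
    (hc : ∀ y, cos (y + c) = -cos y) : angleRhs w B A t (x + c) = angleRhs w A B t x := by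
  simp only [angleRhs, hs, hc, neg_neg]
  ring

namespace IsAngle

variable {T₁ T₂ : ℝ} {w A B θ θ' : ℝ → ℝ}

/-- At a multiple `c` of `π` the right-hand side is `w > 0`. The constant `c` is therefore a strict
subsolution, with defect `-w`, and the angle can cross it only upwards. -/
theorem lt_of_sin_eq_zero (h : IsAngle T₁ T₂ w A B θ) (hw : Continuous w) (hA : Continuous A)
    (hB : Continuous B) (hw0 : ∀ t, 0 < w t) {c s t : ℝ} (hc : sin c = 0) (hs : T₁ ≤ s)
    (hst : s < t) (ht : t ≤ T₂) (hcs : c ≤ θ s) : c < θ t := by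
  refine angle_compare_strict hw hA hB (g₁ := fun t => -w t) (g₂ := fun _ => 0) hst
    continuous_const h.1 hw.neg continuous_const (fun τ _ => ?_) (fun τ hτ => ?_)
    (fun τ _ => neg_lt_zero.2 (hw0 τ)) hcs
  · rw [angleRhs_of_sin_eq_zero hc, add_neg_cancel]
    exact hasDerivAt_const _ _
  · rw [add_zero]
    exact h.2 τ ⟨hs.trans_lt hτ.1, hτ.2.trans_le ht⟩

theorem le_of_sin_eq_zero (h : IsAngle T₁ T₂ w A B θ) (hw : Continuous w) (hA : Continuous A)
    (hB : Continuous B) (hw0 : ∀ t, 0 < w t) {c s t : ℝ} (hc : sin c = 0) (hs : T₁ ≤ s)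
    (hst : s ≤ t) (ht : t ≤ T₂) (hcs : c ≤ θ s) : c ≤ θ t := by
  rcases hst.eq_or_lt with rfl | hlt
  · exact hcs
  · exact (h.lt_of_sin_eq_zero hw hA hB hw0 hc hs hlt ht hcs).le

/-- A constant at which the right-hand side is nonpositive is a supersolution. -/
theorem compare_const (h : IsAngle T₁ T₂ w A B θ) (hw : Continuous w) (hA : Continuous A)
    (hB : Continuous B) (hT : T₁ ≤ T₂) {c : ℝ} (hc : ∀ t ∈ Icc T₁ T₂, angleRhs w A B t c ≤ 0) :
    (θ T₁ ≤ c → θ T₂ ≤ c) ∧ (θ T₁ < c → θ T₂ < c) := by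
  refine angle_compare hw hA hB (g₁ := fun _ => 0) (g₂ := fun t => -angleRhs w A B t c) hT
    h.1 continuous_const continuous_const (continuous_angleRhs hw hA hB continuous_const).neg
    (fun τ hτ => ?_) (fun τ _ => ?_) fun τ hτ => neg_nonneg.2 (hc τ hτ)
  · rw [add_zero]
    exact h.2 τ hτ
  · rw [add_neg_cancel]
    exact hasDerivAt_const _ _

theorem compare (h : IsAngle T₁ T₂ w A B θ) (h' : IsAngle T₁ T₂ w A B θ') (hw : Continuous w)
    (hA : Continuous A) (hB : Continuous B) (hT : T₁ ≤ T₂) :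
    (θ T₁ ≤ θ' T₁ → θ T₂ ≤ θ' T₂) ∧ (θ T₁ < θ' T₁ → θ T₂ < θ' T₂) := by
  refine angle_compare hw hA hB (g₁ := fun _ => 0) (g₂ := fun _ => 0) hT
    h.1 h'.1 continuous_const continuous_const (fun τ hτ => ?_) (fun τ hτ => ?_) fun τ hτ => le_rfl
  · rw [add_zero]
    exact h.2 τ hτ
  · rw [add_zero]
    exact h'.2 τ hτ

theorem mono (h : IsAngle T₁ T₂ w A B θ) {s e : ℝ} (hs : T₁ ≤ s) (he : e ≤ T₂) :
    IsAngle s e w A B θ :=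
  ⟨h.1, fun t ht => h.2 t ⟨hs.trans_lt ht.1, ht.2.trans_le he⟩⟩

theorem unique (h : IsAngle T₁ T₂ w A B θ) (h' : IsAngle T₁ T₂ w A B θ') (hw : Continuous w)
    (hA : Continuous A) (hB : Continuous B) (h0 : θ T₁ = θ' T₁) {t : ℝ} (ht : t ∈ Icc T₁ T₂) :
    θ t = θ' t :=
  le_antisymm
    (((h.mono le_rfl ht.2).compare (h'.mono le_rfl ht.2) hw hA hB ht.1).1 h0.le)
    (((h'.mono le_rfl ht.2).compare (h.mono le_rfl ht.2) hw hA hB ht.1).1 h0.ge)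

theorem injOn (h : IsAngle T₁ T₂ w A B θ) (hw : Continuous w) (hA : Continuous A)
    (hB : Continuous B) (hw0 : ∀ t, 0 < w t) :
    InjOn θ {t | t ∈ Ioo T₁ T₂ ∧ sin (θ t) = 0} := by
  intro s hs t ht e
  rcases lt_trichotomy s t with hlt | rfl | hlt
  · exact absurd e (h.lt_of_sin_eq_zero hw hA hB hw0 hs.2 hs.1.1.le hlt ht.1.2.le le_rfl).ne
  · rfl
  · exact absurd e (h.lt_of_sin_eq_zero hw hA hB hw0 ht.2 ht.1.1.le hlt hs.1.2.le le_rfl).ne'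

theorem countable_zeros (h : IsAngle T₁ T₂ w A B θ) (hw : Continuous w) (hA : Continuous A)
    (hB : Continuous B) (hw0 : ∀ t, 0 < w t) :
    {t | t ∈ Ioo T₁ T₂ ∧ sin (θ t) = 0}.Countable := by
  refine countable_of_injective_of_countable_image (h.injOn hw hA hB hw0) ?_
  refine (countable_range fun i : ℤ => (i : ℝ) * π).mono ?_
  rintro _ ⟨t, ht, rfl⟩
  exact sin_eq_zero_iff.1 ht.2

/-- Both end angles are odd multiples of `π / 2`, and the multiple of `π` just below the initial
angle is a barrier from below. -/
theorem exists_nat (h : IsAngle T₁ T₂ w A B θ) (hw : Continuous w) (hA : Continuous A)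
    (hB : Continuous B) (hw0 : ∀ t, 0 < w t) (hT : T₁ < T₂) (h1 : cos (θ T₁) = 0)
    (h2 : cos (θ T₂) = 0) : ∃ j : ℕ, θ T₂ = θ T₁ + j * π := by
  obtain ⟨a, ha⟩ := cos_eq_zero_iff.1 h1
  obtain ⟨b, hb⟩ := cos_eq_zero_iff.1 h2
  have hc : sin (θ T₁ - π / 2) = 0 := by rw [sin_sub_pi_div_two, h1, neg_zero]
  have hlt := h.lt_of_sin_eq_zero hw hA hB hw0 hc le_rfl hT le_rfl (by linarith [pi_pos])
  have hab : a ≤ b := by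
    by_contra! hba
    have : (b : ℝ) + 1 ≤ a := by exact_mod_cast hba
    nlinarith [pi_pos]
  refine ⟨(b - a).toNat, ?_⟩
  have e : (((b - a).toNat : ℤ) : ℝ) = b - a := by
    rw [Int.toNat_of_nonneg (by omega)]
    push_cast
    rfl
  rw [Int.cast_natCast] at e
  rw [e, ha, hb]
  ring

theorem encard_zeros (h : IsAngle T₁ T₂ w A B θ) (hw : Continuous w) (hA : Continuous A)
    (hB : Continuous B) (hw0 : ∀ t, 0 < w t) (hT : T₁ < T₂) (h1 : cos (θ T₁) = 0) {j : ℕ}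
    (h2 : θ T₂ = θ T₁ + j * π) : {t | t ∈ Ioo T₁ T₂ ∧ sin (θ t) = 0}.encard = j := by
  have hpi := pi_pos
  have hs : ∀ i : ℕ, sin (θ T₁ + π / 2 + i * π) = 0 := fun i => by
    rw [sin_add_nat_mul_pi, sin_add_pi_div_two, h1, mul_zero]
  have hc : sin (θ T₁ - π / 2) = 0 := by rw [sin_sub_pi_div_two, h1, neg_zero]
  -- Each multiple of `π` is met at most once, so zeros can be counted by their angles. Those
  -- strictly between the end angles are attained by the intermediate value theorem, and the
  -- barriers exclude all others.
  have himg : θ '' {t | t ∈ Ioo T₁ T₂ ∧ sin (θ t) = 0} =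
      (fun i : ℕ => θ T₁ + π / 2 + i * π) '' (Finset.range j : Set ℕ) := by
    ext y
    constructor
    · rintro ⟨t, ⟨ht, hst⟩, rfl⟩
      obtain ⟨i, hi⟩ := sin_eq_zero_iff.1 hst
      obtain ⟨i₀, hi₀⟩ := sin_eq_zero_iff.1 hc
      have hlo := h.lt_of_sin_eq_zero hw hA hB hw0 hc le_rfl ht.1 ht.2.le (by linarith)
      have hhi : θ t < θ T₁ + π / 2 + j * π := by
        by_contra! hge
        have := h.lt_of_sin_eq_zero hw hA hB hw0 (hs j) ht.1.le ht.2 le_rfl hge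
        linarith
      have a1 : i₀ < i := by
        have : (i₀ : ℝ) < i := by
          rw [← hi, ← hi₀] at hlo
          exact lt_of_mul_lt_mul_right hlo hpi.le
        exact_mod_cast this
      have a2 : i < i₀ + 1 + j := by
        have : (i : ℝ) < i₀ + 1 + j := by
          refine lt_of_mul_lt_mul_right (a := π) ?_ hpi.le
          rw [hi, add_mul, add_mul, hi₀]
          linarith
        exact_mod_cast this
      refine ⟨(i - i₀ - 1).toNat, ?_, ?_⟩
      · simp only [Finset.coe_range, mem_Iio]
        omega
      · have e : (((i - i₀ - 1).toNat : ℤ) : ℝ) = i - i₀ - 1 := by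
          rw [Int.toNat_of_nonneg (by omega)]
          push_cast
          rfl
        rw [Int.cast_natCast] at e
        simp only [e]
        linear_combination hi - hi₀
    · rintro ⟨i, hi, rfl⟩
      have hij : (i : ℝ) + 1 ≤ j := by
        have : i < j := by simpa using hi
        exact_mod_cast this
      have hi0 : (0 : ℝ) ≤ i := Nat.cast_nonneg i
      have hlo : θ T₁ < θ T₁ + π / 2 + i * π := by nlinarith
      have hhi : θ T₁ + π / 2 + i * π < θ T₂ := by nlinarith
      obtain ⟨t, ht, e⟩ := intermediate_value_Icc hT.le h.1.continuousOn ⟨hlo.le, hhi.le⟩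
      refine ⟨t, ⟨⟨lt_of_le_of_ne ht.1 ?_, lt_of_le_of_ne ht.2 ?_⟩, by rw [e, hs]⟩, e⟩
      · rintro rfl
        exact hlo.ne e
      · rintro rfl
        exact hhi.ne' e
  rw [← (h.injOn hw hA hB hw0).encard_image, himg, InjOn.encard_image,
    encard_coe_eq_coe_finsetCard, Finset.card_range]
  intro i _ i' _ e
  have : (i : ℝ) * π = i' * π := by simpa using e
  exact_mod_cast mul_right_cancel₀ hpi.ne' this

/-- The weighted energy of the positive humps is the (positive) Dirichlet energy. -/
theorem integral_pos_of_cos_eq_zero (h : IsAngle T₁ T₂ w A B θ) (hw : Continuous w)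
    (hA : Continuous A) (hB : Continuous B) (hw0 : ∀ t, 0 < w t) (hT : T₁ < T₂)
    (h1 : cos (θ T₁) = 0) (h2 : cos (θ T₂) = 0) {q : ℝ → ℝ} (hq : Continuous q)
    (hq0 : ∀ t, 0 ≤ q t) (hpos : ∃ t ∈ Icc T₁ T₂, 0 < sin (θ t) ∧ cos (θ t) ≠ 0) :
    0 < ∫ t in T₁..T₂, exp (-∫ τ in T₁..t, angleRhsDeriv w A B τ (θ τ)) *
      ((A t + q t) * max (sin (θ t)) 0 ^ 2) := by
  have hθ := h.1
  have hκ : Continuous fun τ => angleRhsDeriv w A B τ (θ τ) := by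
    unfold angleRhsDeriv
    fun_prop
  -- `R` is the square of the Prüfer radius, normalized at `T₁`; thus `R sin θ cos θ` is `u · p u'`.
  set R : ℝ → ℝ := fun t => exp (-∫ τ in T₁..t, angleRhsDeriv w A B τ (θ τ)) with hR
  have hR0 : ∀ t, 0 < R t := fun t => exp_pos _
  have hRd : ∀ t, HasDerivAt R (-(angleRhsDeriv w A B t (θ t)) * R t) t := fun t => by
    have := (intervalIntegral.integral_hasDerivAt_right (a := T₁) (b := t)
      (hκ.intervalIntegrable _ _)
      hκ.aestronglyMeasurable.stronglyMeasurableAtFilter hκ.continuousAt).neg.exp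
    convert! this using 1
    rw [hR, mul_comm]
    rfl
  have hRc : Continuous R := continuous_iff_continuousAt.2 fun t => (hRd t).continuousAt
  have hO : IsOpen {t | 0 < sin (θ t)} := isOpen_lt continuous_const (by fun_prop)
  -- The energy density `p u'² + q u²`, cut off to the positive humps. It may jump at zeros of `u`,
  -- so the fundamental theorem is applied off this countable set.
  set E : ℝ → ℝ := {t | 0 < sin (θ t)}.indicator
    fun t => R t * (w t * cos (θ t) ^ 2 + q t * sin (θ t) ^ 2) with hE
  have hEi : IntervalIntegrable E MeasureTheory.volume T₁ T₂ := by
    have hc : Continuous fun t => R t * (w t * cos (θ t) ^ 2 + q t * sin (θ t) ^ 2) := by fun_prop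
    have := hc.intervalIntegrable (μ := MeasureTheory.volume) T₁ T₂
    exact ⟨this.1.indicator hO.measurableSet, this.2.indicator hO.measurableSet⟩
  have hc2 : Continuous fun t => R t * ((A t + q t) * max (sin (θ t)) 0 ^ 2) := by fun_prop
  have hint := MeasureTheory.integral_eq_of_hasDerivAt_off_countable
    (fun t => R t * (max (sin (θ t)) 0 * cos (θ t)))
    (fun t => E t - R t * ((A t + q t) * max (sin (θ t)) 0 ^ 2)) (a := T₁) (b := T₂)
    (h.countable_zeros hw hA hB hw0) (Continuous.continuousOn (by fun_prop)) (fun t ht => by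
      rw [min_eq_left hT.le, max_eq_right hT.le] at ht
      have ht1 : t ∈ Ioo T₁ T₂ := ht.1
      have hd := h.2 t ht1
      have hsd : HasDerivAt (fun t => sin (θ t)) (cos (θ t) * angleRhs w A B t (θ t)) t := hd.sin
      have hcd : HasDerivAt (fun t => cos (θ t)) (-sin (θ t) * angleRhs w A B t (θ t)) t := hd.cos
      rcases lt_or_gt_of_ne (fun e => ht.2 ⟨ht1, e⟩ : sin (θ t) ≠ 0) with hneg | hp
      · have e0 : E t - R t * ((A t + q t) * max (sin (θ t)) 0 ^ 2) = 0 := by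
          rw [hE, indicator_of_notMem (by simpa using hneg.le), max_eq_right hneg.le]
          ring
        rw [e0]
        refine (hasDerivAt_const t (0 : ℝ)).congr_of_eventuallyEq ?_
        filter_upwards [hsd.continuousAt.eventually (gt_mem_nhds hneg)] with x hx
        rw [max_eq_right hx.le]
        ring
      · have e1 : (fun t => R t * (max (sin (θ t)) 0 * cos (θ t))) =ᶠ[𝓝 t]
            fun t => R t * (sin (θ t) * cos (θ t)) := by
          filter_upwards [hsd.continuousAt.eventually (lt_mem_nhds hp)] with x hx
          rw [max_eq_left hx.le]
        refine HasDerivAt.congr_of_eventuallyEq ?_ e1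
        convert! (hRd t).mul (hsd.mul hcd) using 1
        rw [hE, indicator_of_mem (by exact hp), max_eq_left hp.le, angleRhsDeriv, angleRhs,
          max_eq_left hp.le, max_eq_right (neg_nonpos.2 hp.le)]
        simp only [Pi.mul_apply]
        linear_combination (-R t * (w t * cos (θ t) ^ 2 - A t * sin (θ t) ^ 2)) *
          sin_sq_add_cos_sq (θ t)) (hEi.sub (hc2.intervalIntegrable _ _))
  rw [intervalIntegral.integral_sub hEi (hc2.intervalIntegrable _ _)] at hint
  simp only [h1, h2, mul_zero, sub_zero] at hint
  have hc3 : Continuous fun t => R t * (w t * cos (θ t) ^ 2 * max (sin (θ t)) 0) := by fun_prop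
  -- The extra factor `sin⁺ ≤ 1` gives a continuous minorant of `E`, for which positivity at one
  -- point suffices.
  have hlow : (∫ t in T₁..T₂, R t * (w t * cos (θ t) ^ 2 * max (sin (θ t)) 0)) ≤
      ∫ t in T₁..T₂, E t := by
    refine intervalIntegral.integral_mono_on hT.le (hc3.intervalIntegrable _ _) hEi fun t _ => ?_
    by_cases hp : 0 < sin (θ t)
    · rw [hE, indicator_of_mem (by exact hp), max_eq_left hp.le]
      refine mul_le_mul_of_nonneg_left ?_ (hR0 t).le
      have a1 : w t * cos (θ t) ^ 2 * sin (θ t) ≤ w t * cos (θ t) ^ 2 :=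
        mul_le_of_le_one_right (mul_nonneg (hw0 t).le (sq_nonneg _)) (sin_le_one _)
      have a2 : 0 ≤ q t * sin (θ t) ^ 2 := mul_nonneg (hq0 t) (sq_nonneg _)
      linarith
    · rw [hE, indicator_of_notMem (by exact hp), max_eq_right (not_lt.1 hp)]
      simp
  have hlow' : 0 < ∫ t in T₁..T₂, R t * (w t * cos (θ t) ^ 2 * max (sin (θ t)) 0) := by
    refine intervalIntegral.integral_pos hT hc3.continuousOn (fun t _ => ?_) ?_
    · exact mul_nonneg (hR0 t).le (mul_nonneg (mul_nonneg (hw0 t).le (sq_nonneg _))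
        (le_max_right _ _))
    · obtain ⟨t, ht, hs, hc⟩ := hpos
      refine ⟨t, ht, mul_pos (hR0 t) (mul_pos (mul_pos (hw0 t) (by positivity)) ?_)⟩
      rwa [max_eq_left hs.le]
  linarith

end IsAngle
end Fucik

/-! ### Dependence of the final angle on the two parameters. -/

namespace Fucik
open Set Filter Topology Real

/-- Coefficients of the Neumann problem, extended continuously to the real line. -/
structure Coeffs where
  (T₁ T₂ : ℝ)
  (p q m n : ℝ → ℝ)
  lt : T₁ < T₂
  p_cont : Continuous p
  q_cont : Continuous q
  m_cont : Continuous m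
  n_cont : Continuous n
  p_pos : ∀ t, 0 < p t
  q_nonneg : ∀ t, 0 ≤ q t

namespace Coeffs

variable (D : Coeffs)

/-- The reciprocal of the leading coefficient. -/
noncomputable def w (t : ℝ) : ℝ := (D.p t)⁻¹
/-- The potential on positive humps. -/
def A (x : ℝ × ℝ) (t : ℝ) : ℝ := x.1 * D.m t - D.q t
/-- The potential on negative humps. -/
def B (x : ℝ × ℝ) (t : ℝ) : ℝ := x.2 * D.n t - D.q t

/-- The two weights exchanged. -/
def swap : Coeffs :=
  { D with m := D.n, n := D.m, m_cont := D.n_cont, n_cont := D.m_cont }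

/-- The first weight used for both signs. -/
def diag : Coeffs := { D with n := D.m, n_cont := D.m_cont }

theorem w_cont : Continuous D.w := D.p_cont.inv₀ fun t => (D.p_pos t).ne'
theorem w_pos (t : ℝ) : 0 < D.w t := inv_pos.2 (D.p_pos t)
theorem A_cont (x : ℝ × ℝ) : Continuous (D.A x) := (D.m_cont.const_mul _).sub D.q_cont
theorem B_cont (x : ℝ × ℝ) : Continuous (D.B x) := (D.n_cont.const_mul _).sub D.q_cont

/-- The angle that starts at `θ₀`. -/
noncomputable def angle (θ₀ : ℝ) (x : ℝ × ℝ) : ℝ → ℝ :=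
  (exists_isAngle D.lt D.w_cont (D.A_cont x) (D.B_cont x) θ₀).choose

variable (θ₀ : ℝ) (x y : ℝ × ℝ)

theorem isAngle : IsAngle D.T₁ D.T₂ D.w (D.A x) (D.B x) (D.angle θ₀ x) :=
  (exists_isAngle D.lt D.w_cont (D.A_cont x) (D.B_cont x) θ₀).choose_spec.1

theorem angle_left : D.angle θ₀ x D.T₁ = θ₀ :=
  (exists_isAngle D.lt D.w_cont (D.A_cont x) (D.B_cont x) θ₀).choose_spec.2.1

theorem angle_projIcc (t : ℝ) : D.angle θ₀ x (projIcc D.T₁ D.T₂ D.lt.le t) = D.angle θ₀ x t :=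
  (exists_isAngle D.lt D.w_cont (D.A_cont x) (D.B_cont x) θ₀).choose_spec.2.2 t

theorem angle_cont_time : Continuous (D.angle θ₀ x) := (D.isAngle θ₀ x).1

/-- Shifting the angle by an odd multiple of `π` replaces `u` by `-u`, which exchanges the roles of
the two weights. -/
theorem angle_swap {c : ℝ} (hs : ∀ y, sin (y + c) = -sin y) (hc : ∀ y, cos (y + c) = -cos y)
    {t : ℝ} (ht : t ∈ Icc D.T₁ D.T₂) :
    D.swap.angle (θ₀ + c) x.swap t = D.angle θ₀ x t + c := by
  have h : IsAngle D.T₁ D.T₂ D.w (D.B x) (D.A x) (fun t => D.angle θ₀ x t + c) :=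
    ⟨(D.angle_cont_time θ₀ x).add continuous_const, fun t ht => by
      rw [angleRhs_add_of_neg hs hc]
      exact ((D.isAngle θ₀ x).2 t ht).add_const c⟩
  exact (D.swap.isAngle (θ₀ + c) x.swap).unique h D.w_cont (D.B_cont x) (D.A_cont x)
    ((D.swap.angle_left _ _).trans (congrArg (· + c) (D.angle_left θ₀ x).symm)) ht

/-- The mean slope of the angle equation between the angles for `x` and `y`. -/
noncomputable def slope (t : ℝ) : ℝ :=
  angleSlope D.w (D.A x) (D.B x) t (D.angle θ₀ x t) (D.angle θ₀ y t)

theorem slope_cont_time : Continuous (D.slope θ₀ x y) :=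
  continuous_angleSlope_along D.w_cont (D.A_cont x) (D.B_cont x) (D.angle_cont_time θ₀ x)
    (D.angle_cont_time θ₀ y)

/-- The angle for `y` solves the equation for `x` with a perturbation that is linear in `y - x`;
both angles start at `θ₀`. -/
theorem angle_sub {t : ℝ} (ht : t ∈ Icc D.T₁ D.T₂) :
    exp (-∫ τ in D.T₁..t, D.slope θ₀ x y τ) * (D.angle θ₀ y t - D.angle θ₀ x t) =
      ∫ s in D.T₁..t, exp (-∫ τ in D.T₁..s, D.slope θ₀ x y τ) *
        ((y.1 - x.1) * (D.m s * max (sin (D.angle θ₀ y s)) 0 ^ 2) +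
          (y.2 - x.2) * (D.n s * max (-sin (D.angle θ₀ y s)) 0 ^ 2)) := by
  have hm := D.m_cont
  have hn := D.n_cont
  have hθ := D.angle_cont_time θ₀ y
  have := angle_diff D.w_cont (D.A_cont x) (D.B_cont x) (g₁ := fun _ => 0)
    (g₂ := fun s => (y.1 - x.1) * (D.m s * max (sin (D.angle θ₀ y s)) 0 ^ 2) +
          (y.2 - x.2) * (D.n s * max (-sin (D.angle θ₀ y s)) 0 ^ 2)) ht.1
    (D.angle_cont_time θ₀ x) hθ continuous_const (by fun_prop)
    (fun τ hτ => by
      rw [add_zero]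
      exact (D.isAngle θ₀ x).2 τ ⟨hτ.1, hτ.2.trans_le ht.2⟩)
    (fun τ hτ => by
      convert! (D.isAngle θ₀ y).2 τ ⟨hτ.1, hτ.2.trans_le ht.2⟩ using 1
      simp only [angleRhs, A, B]
      ring)
  simp only [sub_zero, D.angle_left, sub_self] at this
  exact this.symm

/-- The mean slope involves only the potentials for `x`, so the constant is uniform in `y` and in
time. -/
theorem exists_angle_bound : ∃ C, ∀ y, ∀ t ∈ Icc D.T₁ D.T₂,
    |D.angle θ₀ y t - D.angle θ₀ x t| ≤ C * (|y.1 - x.1| + |y.2 - x.2|) := by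
  have hb : Continuous fun t => |D.w t| + |D.A x t| + |D.B x t| := by
    have := D.w_cont
    have := D.A_cont x
    have := D.B_cont x
    fun_prop
  have hb' : Continuous fun t => |D.m t| + |D.n t| := by
    have := D.m_cont
    have := D.n_cont
    fun_prop
  obtain ⟨c, hc⟩ := isCompact_Icc.exists_bound_of_continuousOn (s := Icc D.T₁ D.T₂) hb.continuousOn
  obtain ⟨d, hd⟩ := isCompact_Icc.exists_bound_of_continuousOn (s := Icc D.T₁ D.T₂) hb'.continuousOn
  have hc' : ∀ t ∈ Icc D.T₁ D.T₂, |D.w t| + |D.A x t| + |D.B x t| ≤ c := fun t ht =>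
    (le_abs_self _).trans (hc t ht)
  have hd' : ∀ t ∈ Icc D.T₁ D.T₂, |D.m t| + |D.n t| ≤ d := fun t ht =>
    (le_abs_self _).trans (hd t ht)
  have hl : D.T₁ ∈ Icc D.T₁ D.T₂ := left_mem_Icc.2 D.lt.le
  have hc0 : 0 ≤ c := le_trans (by positivity) (hc' _ hl)
  have hd0 : 0 ≤ d := le_trans (by positivity) (hd' _ hl)
  set K := 2 * c * (D.T₂ - D.T₁) with hK
  refine ⟨exp K * (exp K * d * (D.T₂ - D.T₁)), fun y t ht => ?_⟩
  set e := |y.1 - x.1| + |y.2 - x.2| with he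
  have he0 : 0 ≤ e := by positivity
  have hint : ∀ s ∈ Icc D.T₁ D.T₂, |∫ τ in D.T₁..s, D.slope θ₀ x y τ| ≤ K := by
    intro s hs
    have := intervalIntegral.norm_integral_le_of_norm_le_const (a := D.T₁) (b := s)
      (f := D.slope θ₀ x y) (C := 2 * c) (fun τ hτ => by
        rw [uIoc_of_le hs.1] at hτ
        refine (abs_angleSlope_le _ _ _ _ _ _).trans ?_
        have := hc' τ ⟨hτ.1.le, hτ.2.trans hs.2⟩
        linarith)
    rw [abs_of_nonneg (sub_nonneg.2 hs.1)] at this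
    refine this.trans ?_
    rw [hK]
    have := hs.2
    gcongr
  have hI : |exp (-∫ τ in D.T₁..t, D.slope θ₀ x y τ) * (D.angle θ₀ y t - D.angle θ₀ x t)| ≤
      exp K * d * (D.T₂ - D.T₁) * e := by
    rw [D.angle_sub θ₀ x y ht]
    have := intervalIntegral.norm_integral_le_of_norm_le_const (a := D.T₁) (b := t)
      (f := fun s => exp (-∫ τ in D.T₁..s, D.slope θ₀ x y τ) *
        ((y.1 - x.1) * (D.m s * max (sin (D.angle θ₀ y s)) 0 ^ 2) +
          (y.2 - x.2) * (D.n s * max (-sin (D.angle θ₀ y s)) 0 ^ 2)))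
      (C := exp K * (d * e)) (fun s hs => by
        rw [uIoc_of_le ht.1] at hs
        have hs' : s ∈ Icc D.T₁ D.T₂ := ⟨hs.1.le, hs.2.trans ht.2⟩
        rw [Real.norm_eq_abs, abs_mul, abs_of_pos (exp_pos _)]
        have b1 : exp (-∫ τ in D.T₁..s, D.slope θ₀ x y τ) ≤ exp K :=
          exp_le_exp.2 ((neg_le_abs _).trans (hint s hs'))
        have b2 : |D.m s| ≤ d := le_trans (by linarith [abs_nonneg (D.n s)]) (hd' s hs')
        have b3 : |D.n s| ≤ d := le_trans (by linarith [abs_nonneg (D.m s)]) (hd' s hs')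
        have s1 : |max (sin (D.angle θ₀ y s)) 0 ^ 2| ≤ 1 := by
          rw [abs_of_nonneg (sq_nonneg _)]
          exact pow_le_one₀ (le_max_right _ _) (max_le (sin_le_one _) zero_le_one)
        have s2 : |max (-sin (D.angle θ₀ y s)) 0 ^ 2| ≤ 1 := by
          rw [abs_of_nonneg (sq_nonneg _)]
          exact pow_le_one₀ (le_max_right _ _)
            (max_le (by linarith [neg_one_le_sin (D.angle θ₀ y s)]) zero_le_one)
        refine mul_le_mul b1 ?_ (abs_nonneg _) (exp_pos _).le
        refine (abs_add_le _ _).trans ?_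
        rw [abs_mul, abs_mul, abs_mul, abs_mul, he, mul_add, mul_comm d, mul_comm d]
        have t1 : |D.m s| * |max (sin (D.angle θ₀ y s)) 0 ^ 2| ≤ d :=
          (mul_le_of_le_one_right (abs_nonneg _) s1).trans b2
        have t2 : |D.n s| * |max (-sin (D.angle θ₀ y s)) 0 ^ 2| ≤ d :=
          (mul_le_of_le_one_right (abs_nonneg _) s2).trans b3
        gcongr)
    rw [abs_of_nonneg (sub_nonneg.2 ht.1)] at this
    refine this.trans ?_
    have h2 := ht.2
    calc exp K * (d * e) * (t - D.T₁) ≤ exp K * (d * e) * (D.T₂ - D.T₁) := by gcongr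
      _ = _ := by ring
  rw [abs_mul, abs_of_pos (exp_pos _)] at hI
  have hlow : exp (-K) ≤ exp (-∫ τ in D.T₁..t, D.slope θ₀ x y τ) :=
    exp_le_exp.2 (neg_le_neg ((le_abs_self _).trans (hint t ht)))
  have h3 : exp (-K) * |D.angle θ₀ y t - D.angle θ₀ x t| ≤ exp K * d * (D.T₂ - D.T₁) * e :=
    (mul_le_mul_of_nonneg_right hlow (abs_nonneg _)).trans hI
  calc |D.angle θ₀ y t - D.angle θ₀ x t|
      = exp K * (exp (-K) * |D.angle θ₀ y t - D.angle θ₀ x t|) := by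
        rw [← mul_assoc, ← exp_add, add_neg_cancel, exp_zero, one_mul]
    _ ≤ exp K * (exp K * d * (D.T₂ - D.T₁) * e) := mul_le_mul_of_nonneg_left h3 (exp_pos _).le
    _ = _ := by ring

theorem angle_cont : Continuous fun z : (ℝ × ℝ) × ℝ => D.angle θ₀ z.1 z.2 := by
  rw [continuous_iff_continuousAt]
  rintro ⟨x, t⟩
  obtain ⟨C, hC⟩ := D.exists_angle_bound θ₀ x
  have hC' : ∀ y s, |D.angle θ₀ y s - D.angle θ₀ x s| ≤ C * (|y.1 - x.1| + |y.2 - x.2|) := by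
    intro y s
    rw [← D.angle_projIcc θ₀ y, ← D.angle_projIcc θ₀ x]
    exact hC y _ (projIcc D.T₁ D.T₂ D.lt.le s).2
  have h1 : Tendsto (fun z : (ℝ × ℝ) × ℝ => D.angle θ₀ z.1 z.2 - D.angle θ₀ x z.2) (𝓝 (x, t))
      (𝓝 0) := by
    refine squeeze_zero_norm (fun z => hC' z.1 z.2) ?_
    have : Continuous fun z : (ℝ × ℝ) × ℝ => C * (|z.1.1 - x.1| + |z.1.2 - x.2|) := by fun_prop
    simpa using this.tendsto (x, t)
  have h2 : Tendsto (fun z : (ℝ × ℝ) × ℝ => D.angle θ₀ x z.2) (𝓝 (x, t)) (𝓝 (D.angle θ₀ x t)) :=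
    ((D.angle_cont_time θ₀ x).comp continuous_snd).tendsto (x, t)
  have := h1.add h2
  simp only [sub_add_cancel, zero_add] at this
  exact this

theorem slope_cont :
    Continuous fun z : ((ℝ × ℝ) × (ℝ × ℝ)) × ℝ => D.slope θ₀ z.1.1 z.1.2 z.2 := by
  have hw := D.w_cont
  have hm := D.m_cont
  have hn := D.n_cont
  have hq := D.q_cont
  have h1 : Continuous fun z : ((ℝ × ℝ) × (ℝ × ℝ)) × ℝ => D.angle θ₀ z.1.1 z.2 :=
    (D.angle_cont θ₀).comp (f := fun z : ((ℝ × ℝ) × (ℝ × ℝ)) × ℝ => (z.1.1, z.2)) (by fun_prop)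
  have h2 : Continuous fun z : ((ℝ × ℝ) × (ℝ × ℝ)) × ℝ => D.angle θ₀ z.1.2 z.2 :=
    (D.angle_cont θ₀).comp (f := fun z : ((ℝ × ℝ) × (ℝ × ℝ)) × ℝ => (z.1.2, z.2)) (by fun_prop)
  exact continuous_angleSlope (X := ((ℝ × ℝ) × (ℝ × ℝ)) × ℝ) (w := fun z => D.w z.2)
    (A := fun z => z.1.1.1 * D.m z.2 - D.q z.2) (B := fun z => z.1.1.2 * D.n z.2 - D.q z.2)
    (by fun_prop) (by fun_prop) (by fun_prop) h1 h2

/-- The difference quotient of the final angle in the direction of a weight, with `φ` the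
weighted square of the angular function. -/
noncomputable def quotient (φ : ℝ → ℝ → ℝ) (x y : ℝ × ℝ) : ℝ :=
  exp (∫ τ in D.T₁..D.T₂, D.slope θ₀ x y τ) *
    ∫ s in D.T₁..D.T₂, exp (-∫ τ in D.T₁..s, D.slope θ₀ x y τ) * φ s (D.angle θ₀ y s)

theorem quotient_cont {φ : ℝ → ℝ → ℝ} (hφ : Continuous fun z : ℝ × ℝ => φ z.1 z.2) :
    Continuous fun z : (ℝ × ℝ) × (ℝ × ℝ) => D.quotient θ₀ φ z.1 z.2 := by
  have hs := D.slope_cont θ₀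
  have h1 : Continuous fun z : ((ℝ × ℝ) × (ℝ × ℝ)) × ℝ =>
      ∫ τ in D.T₁..z.2, D.slope θ₀ z.1.1 z.1.2 τ :=
    intervalIntegral.continuous_parametric_intervalIntegral_of_continuous
      (X := ((ℝ × ℝ) × (ℝ × ℝ)) × ℝ) (f := fun z τ => D.slope θ₀ z.1.1 z.1.2 τ)
      (hs.comp (f := fun z : (((ℝ × ℝ) × (ℝ × ℝ)) × ℝ) × ℝ => (z.1.1, z.2)) (by fun_prop))
      continuous_snd
  have h2 : Continuous fun z : ((ℝ × ℝ) × (ℝ × ℝ)) × ℝ => φ z.2 (D.angle θ₀ z.1.2 z.2) :=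
    hφ.comp (f := fun z : ((ℝ × ℝ) × (ℝ × ℝ)) × ℝ => (z.2, D.angle θ₀ z.1.2 z.2))
      (continuous_snd.prodMk ((D.angle_cont θ₀).comp
        (f := fun z : ((ℝ × ℝ) × (ℝ × ℝ)) × ℝ => (z.1.2, z.2)) (by fun_prop)))
  refine Continuous.mul ?_ ?_
  · exact continuous_exp.comp (intervalIntegral.continuous_parametric_intervalIntegral_of_continuous'
      (f := fun z : (ℝ × ℝ) × (ℝ × ℝ) => D.slope θ₀ z.1 z.2) hs _ _)
  · exact intervalIntegral.continuous_parametric_intervalIntegral_of_continuous'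
      (f := fun (z : (ℝ × ℝ) × (ℝ × ℝ)) s =>
        exp (-∫ τ in D.T₁..s, D.slope θ₀ z.1 z.2 τ) * φ s (D.angle θ₀ z.2 s))
      ((continuous_exp.comp h1.neg).mul h2) _ _

/-- The weighted square of the positive part. -/
noncomputable def posWeight (t x : ℝ) : ℝ := D.m t * max (sin x) 0 ^ 2
/-- The weighted square of the negative part. -/
noncomputable def negWeight (t x : ℝ) : ℝ := D.n t * max (-sin x) 0 ^ 2

theorem posWeight_cont : Continuous fun z : ℝ × ℝ => D.posWeight z.1 z.2 := by
  have := D.m_cont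
  unfold posWeight
  fun_prop

theorem negWeight_cont : Continuous fun z : ℝ × ℝ => D.negWeight z.1 z.2 := by
  have := D.n_cont
  unfold negWeight
  fun_prop

theorem angle_right_sub :
    D.angle θ₀ y D.T₂ - D.angle θ₀ x D.T₂ =
      (y.1 - x.1) * D.quotient θ₀ D.posWeight x y + (y.2 - x.2) * D.quotient θ₀ D.negWeight x y := by
  have h := D.angle_sub θ₀ x y (right_mem_Icc.2 D.lt.le)
  have hθ := D.angle_cont_time θ₀ y
  have hK : Continuous fun s => ∫ τ in D.T₁..s, D.slope θ₀ x y τ :=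
    intervalIntegral.continuous_primitive
      (fun _ _ => (D.slope_cont_time θ₀ x y).intervalIntegrable _ _) D.T₁
  have hφ : ∀ {φ : ℝ → ℝ → ℝ}, (Continuous fun z : ℝ × ℝ => φ z.1 z.2) →
      IntervalIntegrable (fun s => exp (-∫ τ in D.T₁..s, D.slope θ₀ x y τ) *
        φ s (D.angle θ₀ y s)) MeasureTheory.volume D.T₁ D.T₂ := fun {φ} hφ => by
    have : Continuous fun s => φ s (D.angle θ₀ y s) :=
      hφ.comp (f := fun s => (s, D.angle θ₀ y s)) (by fun_prop)
    exact Continuous.intervalIntegrable (by fun_prop) _ _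
  have e : (fun s => exp (-∫ τ in D.T₁..s, D.slope θ₀ x y τ) *
        ((y.1 - x.1) * (D.m s * max (sin (D.angle θ₀ y s)) 0 ^ 2) +
          (y.2 - x.2) * (D.n s * max (-sin (D.angle θ₀ y s)) 0 ^ 2))) =
      fun s => (y.1 - x.1) * (exp (-∫ τ in D.T₁..s, D.slope θ₀ x y τ) *
        D.posWeight s (D.angle θ₀ y s)) + (y.2 - x.2) *
        (exp (-∫ τ in D.T₁..s, D.slope θ₀ x y τ) * D.negWeight s (D.angle θ₀ y s)) := by
    funext s
    rw [posWeight, negWeight]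
    ring
  rw [e, intervalIntegral.integral_add ((hφ D.posWeight_cont).const_mul _)
    ((hφ D.negWeight_cont).const_mul _), intervalIntegral.integral_const_mul,
    intervalIntegral.integral_const_mul] at h
  set I := ∫ τ in D.T₁..D.T₂, D.slope θ₀ x y τ with hI
  have he : exp I * exp (-I) = 1 := by rw [← exp_add, add_neg_cancel, exp_zero]
  rw [quotient, quotient, ← hI]
  linear_combination (exp I) * h - (D.angle θ₀ y D.T₂ - D.angle θ₀ x D.T₂) * he

/-- Initial angles of the solutions of the Neumann problem. -/
def IsStart (θ₀ : ℝ) : Prop := θ₀ = π / 2 ∨ θ₀ = -(π / 2)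

variable {D θ₀ x}

theorem IsStart.cos_eq_zero (h : IsStart θ₀) : cos θ₀ = 0 := by
  rcases h with rfl | rfl <;> simp

/-- On the diagonal the exponential weight is the squared radius and `x.1 * m = A + q`, so the
integral is the energy of the positive humps. -/
theorem mul_quotient_posWeight_pos (hθ₀ : IsStart θ₀) {k : ℕ} (hk : 1 ≤ k)
    (hx : D.angle θ₀ x D.T₂ = θ₀ + k * π) : 0 < x.1 * D.quotient θ₀ D.posWeight x x := by
  have hpi := pi_pos
  have hk' : (1 : ℝ) ≤ k := by exact_mod_cast hk
  have hT := D.lt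
  have ha := D.isAngle θ₀ x
  -- The angle advances by at least `π` and so takes every value in `[θ₀, θ₀ + π]`. One such value
  -- has positive sine and nonzero cosine: `3π/4` or `π/4`, according to the start.
  have hex : ∃ t ∈ Icc D.T₁ D.T₂, 0 < sin (D.angle θ₀ x t) ∧ cos (D.angle θ₀ x t) ≠ 0 := by
    have key : ∀ c, θ₀ ≤ c → c ≤ θ₀ + π → 0 < sin c → cos c ≠ 0 →
        ∃ t ∈ Icc D.T₁ D.T₂, 0 < sin (D.angle θ₀ x t) ∧ cos (D.angle θ₀ x t) ≠ 0 := by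
      intro c h1 h2 h3 h4
      obtain ⟨t, ht, e⟩ := intermediate_value_Icc hT.le ha.1.continuousOn
        ⟨(D.angle_left θ₀ x).le.trans h1, h2.trans (by rw [hx]; nlinarith)⟩
      exact ⟨t, ht, by rwa [e], by rwa [e]⟩
    rcases hθ₀ with rfl | rfl
    · refine key (π / 2 + π / 4) (by linarith) (by linarith)
        (sin_pos_of_pos_of_lt_pi (by linarith) (by linarith)) ?_
      exact (cos_neg_of_pi_div_two_lt_of_lt (by linarith) (by linarith)).ne
    · refine key (π / 4) (by linarith) (by linarith)
        (sin_pos_of_pos_of_lt_pi (by linarith) (by linarith)) ?_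
      exact (cos_pos_of_mem_Ioo ⟨by linarith, by linarith⟩).ne'
  have h := ha.integral_pos_of_cos_eq_zero D.w_cont (D.A_cont x) (D.B_cont x) D.w_pos hT
    (by rw [D.angle_left, hθ₀.cos_eq_zero])
    (by rw [hx, cos_add_nat_mul_pi, hθ₀.cos_eq_zero, mul_zero]) D.q_cont D.q_nonneg hex
  rw [quotient, mul_left_comm, ← intervalIntegral.integral_const_mul]
  refine mul_pos (exp_pos _) ?_
  convert! h using 1
  refine intervalIntegral.integral_congr fun t _ => ?_
  simp only [slope, angleSlope_self, A, posWeight]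
  ring

/-- If the first parameter vanishes, the right-hand side at `π / 2` is `-q ≤ 0`, so `π / 2` bounds
the angle from above. From `-π / 2` with `k = 1` the target is `π / 2` itself, so strict comparison
is needed. -/
theorem angle_lt_of_fst_eq_zero (hθ₀ : IsStart θ₀) {k : ℕ} (hk : 1 ≤ k) (hx : x.1 = 0) :
    D.angle θ₀ x D.T₂ < θ₀ + k * π := by
  have hpi := pi_pos
  have hk' : (1 : ℝ) ≤ k := by exact_mod_cast hk
  have h := (D.isAngle θ₀ x).compare_const (c := π / 2) D.w_cont (D.A_cont x) (D.B_cont x)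
    D.lt.le (fun t _ => by
      simp only [angleRhs, A, hx, cos_pi_div_two, sin_pi_div_two]
      simpa using D.q_nonneg t)
  rw [D.angle_left] at h
  rcases hθ₀ with rfl | rfl
  · have := h.1 le_rfl
    nlinarith
  · have := h.2 (by linarith)
    nlinarith

theorem exists_shift (hθ₀ : IsStart θ₀) : ∃ c, IsStart (θ₀ + c) ∧
    (∀ y, sin (y + c) = -sin y) ∧ ∀ y, cos (y + c) = -cos y := by
  rcases hθ₀ with rfl | rfl
  · refine ⟨-π, Or.inr (by ring), fun y => ?_, fun y => ?_⟩
    · rw [← sub_eq_add_neg, sin_sub_pi]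
    · rw [← sub_eq_add_neg, cos_sub_pi]
  · exact ⟨π, Or.inl (by ring), fun y => sin_add_pi y, fun y => cos_add_pi y⟩

theorem angle_lt_of_snd_eq_zero (hθ₀ : IsStart θ₀) {k : ℕ} (hk : 1 ≤ k) (hx : x.2 = 0) :
    D.angle θ₀ x D.T₂ < θ₀ + k * π := by
  obtain ⟨c, hc, hs, hcos⟩ := exists_shift hθ₀
  have h := angle_lt_of_fst_eq_zero (D := D.swap) (x := x.swap) hc hk hx
  have e := D.angle_swap θ₀ x hs hcos (right_mem_Icc.2 D.lt.le)
  have h' : D.swap.angle (θ₀ + c) x.swap D.T₂ < θ₀ + c + k * π := h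
  linarith

/-- Transfers to `N` what is proved for `M`: changing the sign of the solution leaves the slope
unchanged and turns negative humps into positive ones. -/
theorem quotient_swap {c : ℝ} (hs : ∀ y, sin (y + c) = -sin y)
    (hc : ∀ y, cos (y + c) = -cos y) :
    D.swap.quotient (θ₀ + c) D.swap.posWeight x.swap x.swap = D.quotient θ₀ D.negWeight x x := by
  have hsl : ∀ t ∈ Icc D.T₁ D.T₂,
      D.swap.slope (θ₀ + c) x.swap x.swap t = D.slope θ₀ x x t := fun t ht => by
    rw [slope, slope, angleSlope_self, angleSlope_self, D.angle_swap θ₀ x hs hc ht]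
    simp only [angleRhsDeriv, hs, hc, neg_neg]
    simp only [swap, w, A, B, Prod.fst_swap, Prod.snd_swap]
    ring
  have hint : ∀ t ∈ Icc D.T₁ D.T₂, ∫ τ in D.T₁..t, D.swap.slope (θ₀ + c) x.swap x.swap τ =
      ∫ τ in D.T₁..t, D.slope θ₀ x x τ := fun t ht =>
    intervalIntegral.integral_congr fun τ hτ => by
      rw [uIcc_of_le ht.1] at hτ
      exact hsl τ ⟨hτ.1, hτ.2.trans ht.2⟩
  rw [quotient, quotient]
  change exp (∫ τ in D.T₁..D.T₂, D.swap.slope (θ₀ + c) x.swap x.swap τ) *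
    (∫ s in D.T₁..D.T₂, exp (-∫ τ in D.T₁..s, D.swap.slope (θ₀ + c) x.swap x.swap τ) *
      D.swap.posWeight s (D.swap.angle (θ₀ + c) x.swap s)) = _
  rw [hint _ (right_mem_Icc.2 D.lt.le)]
  congr 1
  refine intervalIntegral.integral_congr fun s hs' => ?_
  rw [uIcc_of_le D.lt.le] at hs'
  simp only [hint s hs', posWeight, negWeight, D.angle_swap θ₀ x hs hc hs', hs]
  rfl

theorem mul_quotient_negWeight_pos (hθ₀ : IsStart θ₀) {k : ℕ} (hk : 1 ≤ k)
    (hx : D.angle θ₀ x D.T₂ = θ₀ + k * π) : 0 < x.2 * D.quotient θ₀ D.negWeight x x := by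
  obtain ⟨c, hc, hs, hcos⟩ := exists_shift hθ₀
  rw [← quotient_swap hs hcos]
  refine mul_quotient_posWeight_pos (D := D.swap) (x := x.swap) hc hk ?_
  have e := D.angle_swap θ₀ x hs hcos (right_mem_Icc.2 D.lt.le)
  change D.swap.angle (θ₀ + c) x.swap D.T₂ = _
  rw [e, hx]
  ring

theorem upwardLevel (hθ₀ : IsStart θ₀) {k : ℕ} (hk : 1 ≤ k) :
    UpwardLevel (fun x => D.angle θ₀ x D.T₂) (D.quotient θ₀ D.posWeight)
      (D.quotient θ₀ D.negWeight) (θ₀ + k * π) where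
  contM := D.quotient_cont θ₀ D.posWeight_cont
  contN := D.quotient_cont θ₀ D.negWeight_cont
  diff x y := D.angle_right_sub θ₀ x y
  posM _ hx h1 _ := pos_of_mul_pos_right (mul_quotient_posWeight_pos hθ₀ hk hx) h1.le
  posN _ hx _ h2 := pos_of_mul_pos_right (mul_quotient_negWeight_pos hθ₀ hk hx) h2.le
  axis_fst _ := angle_lt_of_snd_eq_zero hθ₀ hk rfl
  axis_snd _ := angle_lt_of_fst_eq_zero hθ₀ hk rfl

end Coeffs
end Fucik

/-! ### Correspondence between Neumann solutions and angles. -/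

namespace Fucik
open Set Filter Topology Real

/-- Supplies the one-sided derivatives at the end points, which the equation inside the interval
does not give directly. -/
theorem hasDerivWithinAt_Icc_of_Ioo {f f' : ℝ → ℝ} {a b : ℝ} (hf : ContinuousOn f (Icc a b))
    (hf' : Continuous f') (h : ∀ t ∈ Ioo a b, HasDerivAt f (f' t) t) {t : ℝ} (ht : t ∈ Icc a b) :
    HasDerivWithinAt f (f' t) (Icc a b) t := by
  have e : ∀ x ∈ Icc a b, f x = f a + ∫ y in a..x, f' y := fun x hx => by
    rw [intervalIntegral.integral_eq_sub_of_hasDerivAt_of_le hx.1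
      (hf.mono (Icc_subset_Icc_right hx.2)) (fun y hy => h y ⟨hy.1, hy.2.trans_le hx.2⟩)
      (hf'.intervalIntegrable _ _)]
    ring
  have hd := (intervalIntegral.integral_hasDerivAt_right (a := a) (b := t)
      (hf'.intervalIntegrable _ _)
      hf'.aestronglyMeasurable.stronglyMeasurableAtFilter hf'.continuousAt).const_add (f a)
  exact hd.hasDerivWithinAt.congr e (e t ht)

/-- The first-order system of the equation `-(u' / w)' = A u⁺ - B u⁻`, with `v = u' / w`. -/
structure IsSystemSolution (T₁ T₂ : ℝ) (w A B u v : ℝ → ℝ) : Prop where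
  contU : ContinuousOn u (Icc T₁ T₂)
  contV : ContinuousOn v (Icc T₁ T₂)
  derivU : ∀ t ∈ Ioo T₁ T₂, HasDerivAt u (w t * v t) t
  derivV : ∀ t ∈ Ioo T₁ T₂, HasDerivAt v (-A t * max (u t) 0 + B t * max (-u t) 0) t

namespace IsSystemSolution

variable {T₁ T₂ : ℝ} {w A B u v u₁ v₁ : ℝ → ℝ}

theorem unique (h : IsSystemSolution T₁ T₂ w A B u v) (h₁ : IsSystemSolution T₁ T₂ w A B u₁ v₁)
    (hw : Continuous w) (hA : Continuous A) (hB : Continuous B) (hu : u T₁ = u₁ T₁)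
    (hv : v T₁ = v₁ T₁) {t : ℝ} (ht : t ∈ Icc T₁ T₂) : u t = u₁ t ∧ v t = v₁ t := by
  have hb : Continuous fun t => |w t| + |A t| + |B t| := by fun_prop
  obtain ⟨c, hc⟩ := isCompact_Icc.exists_bound_of_continuousOn (s := Icc T₁ T₂) hb.continuousOn
  -- Squared distance of the two solutions with a decaying factor; since `c` dominates `|w| + |A| +
  -- |B|`, `F` is nonincreasing, and it starts at `0`.
  set F : ℝ → ℝ := fun t => exp (-c * t) * ((u t - u₁ t) ^ 2 + (v t - v₁ t) ^ 2) with hF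
  have hFc : ContinuousOn F (Icc T₁ T₂) := by
    have := h.contU
    have := h.contV
    have := h₁.contU
    have := h₁.contV
    fun_prop
  have hd : ∀ t ∈ Ioo T₁ T₂, HasDerivAt F (exp (-c * t) * (2 * (u t - u₁ t) *
      (w t * (v t - v₁ t)) + 2 * (v t - v₁ t) * (-A t * (max (u t) 0 - max (u₁ t) 0) +
        B t * (max (-u t) 0 - max (-u₁ t) 0)) -
        c * ((u t - u₁ t) ^ 2 + (v t - v₁ t) ^ 2))) t := fun t ht => by
    have e1 : HasDerivAt (fun t => exp (-c * t)) (exp (-c * t) * -c) t := by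
      simpa using ((hasDerivAt_id t).const_mul (-c)).exp
    have e2 := ((h.derivU t ht).sub (h₁.derivU t ht)).pow 2
    have e3 := ((h.derivV t ht).sub (h₁.derivV t ht)).pow 2
    convert! e1.mul (e2.add e3) using 1
    simp only [Pi.add_apply, Pi.sub_apply, Pi.pow_apply]
    push_cast
    ring
  have hanti : AntitoneOn F (Icc T₁ T₂) := by
    refine antitoneOn_of_deriv_nonpos (convex_Icc _ _) hFc ?_ ?_ <;> rw [interior_Icc]
    · exact fun t ht => (hd t ht).differentiableAt.differentiableWithinAt
    · intro t ht
      rw [(hd t ht).deriv]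
      refine mul_nonpos_of_nonneg_of_nonpos (exp_pos _).le ?_
      have hct : |w t| + |A t| + |B t| ≤ c :=
        (le_abs_self _).trans (hc t (Ioo_subset_Icc_self ht))
      set d := u t - u₁ t
      set e := v t - v₁ t
      have p1 : |max (u t) 0 - max (u₁ t) 0| ≤ |d| := abs_max_sub_max_le_abs _ _ _
      have p2 : |max (-u t) 0 - max (-u₁ t) 0| ≤ |d| := by
        refine (abs_max_sub_max_le_abs _ _ _).trans (le_of_eq ?_)
        rw [← abs_neg]
        congr 1
        ring
      have hde : 2 * (|d| * |e|) ≤ d ^ 2 + e ^ 2 := by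
        nlinarith [sq_nonneg (|d| - |e|), sq_abs d, sq_abs e]
      have q1 : d * (w t * e) ≤ |w t| * (|d| * |e|) := by
        refine (le_abs_self _).trans (le_of_eq ?_)
        rw [abs_mul, abs_mul]
        ring
      have q2 : e * (-A t * (max (u t) 0 - max (u₁ t) 0)) ≤ |A t| * (|d| * |e|) := by
        refine (le_abs_self _).trans ?_
        rw [abs_mul, abs_mul, abs_neg]
        calc |e| * (|A t| * |max (u t) 0 - max (u₁ t) 0|) ≤ |e| * (|A t| * |d|) := by gcongr
          _ = _ := by ring
      have q3 : e * (B t * (max (-u t) 0 - max (-u₁ t) 0)) ≤ |B t| * (|d| * |e|) := by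
        refine (le_abs_self _).trans ?_
        rw [abs_mul, abs_mul]
        calc |e| * (|B t| * |max (-u t) 0 - max (-u₁ t) 0|) ≤ |e| * (|B t| * |d|) := by gcongr
          _ = _ := by ring
      have q4 : (|w t| + |A t| + |B t|) * (2 * (|d| * |e|)) ≤ c * (d ^ 2 + e ^ 2) :=
        mul_le_mul hct hde (by positivity) (le_trans (by positivity) hct)
      nlinarith
  have hle := hanti (left_mem_Icc.2 (ht.1.trans ht.2)) ht ht.1
  simp only [hF, hu, hv, sub_self] at hle
  have hE : (u t - u₁ t) ^ 2 + (v t - v₁ t) ^ 2 ≤ 0 := by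
    refine nonpos_of_mul_nonpos_right (a := exp (-c * t)) (hle.trans (by simp)) (exp_pos _)
  have z1 : (u t - u₁ t) ^ 2 = 0 := by nlinarith [sq_nonneg (u t - u₁ t), sq_nonneg (v t - v₁ t)]
  have z2 : (v t - v₁ t) ^ 2 = 0 := by nlinarith [sq_nonneg (u t - u₁ t), sq_nonneg (v t - v₁ t)]
  exact ⟨sub_eq_zero.1 (pow_eq_zero_iff two_ne_zero |>.1 z1),
    sub_eq_zero.1 (pow_eq_zero_iff two_ne_zero |>.1 z2)⟩

end IsSystemSolution

/-- The radius that belongs to a solution of the angle equation. -/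
noncomputable def radius (T₁ : ℝ) (w A B θ : ℝ → ℝ) (t : ℝ) : ℝ :=
  exp (∫ τ in T₁..t, -(1 / 2) * angleRhsDeriv w A B τ (θ τ))

theorem radius_pos (T₁ : ℝ) (w A B θ : ℝ → ℝ) (t : ℝ) : 0 < radius T₁ w A B θ t := exp_pos _

theorem radius_left (T₁ : ℝ) (w A B θ : ℝ → ℝ) : radius T₁ w A B θ T₁ = 1 := by simp [radius]

theorem hasDerivAt_radius {w A B θ : ℝ → ℝ} (hw : Continuous w) (hA : Continuous A)
    (hB : Continuous B) (hθ : Continuous θ) (T₁ t : ℝ) : HasDerivAt (radius T₁ w A B θ)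
      (radius T₁ w A B θ t * (-(1 / 2) * angleRhsDeriv w A B t (θ t))) t := by
  have hκ : Continuous fun τ => -(1 / 2) * angleRhsDeriv w A B τ (θ τ) := by
    unfold angleRhsDeriv
    fun_prop
  exact (intervalIntegral.integral_hasDerivAt_right (a := T₁) (b := t)
      (hκ.intervalIntegrable _ _)
      hκ.aestronglyMeasurable.stronglyMeasurableAtFilter hκ.continuousAt).exp

/-- The factor `r` must be nonnegative so that it commutes with positive and negative parts; `r = 0`
is allowed and gives the zero solution. -/
theorem IsAngle.isSystemSolution {T₁ T₂ : ℝ} {w A B θ : ℝ → ℝ} (h : IsAngle T₁ T₂ w A B θ)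
    (hw : Continuous w) (hA : Continuous A) (hB : Continuous B) {r : ℝ} (hr : 0 ≤ r) :
    IsSystemSolution T₁ T₂ w A B (fun t => r * (radius T₁ w A B θ t * sin (θ t)))
      (fun t => r * (radius T₁ w A B θ t * cos (θ t))) := by
  have hθ := h.1
  have hR := hasDerivAt_radius hw hA hB hθ T₁
  have hRc : Continuous (radius T₁ w A B θ) :=
    continuous_iff_continuousAt.2 fun t => (hR t).continuousAt
  refine ⟨by fun_prop, by fun_prop, fun t ht => ?_, fun t ht => ?_⟩
  · convert! ((hR t).mul (h.2 t ht).sin).const_mul r using 1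
    rw [angleRhsDeriv, angleRhs]
    rcases le_total (sin (θ t)) 0 with hs | hs
    · rw [max_eq_right hs, max_eq_left (neg_nonneg.2 hs)]
      linear_combination (-(r * radius T₁ w A B θ t * w t * cos (θ t))) * sin_sq_add_cos_sq (θ t)
    · rw [max_eq_left hs, max_eq_right (neg_nonpos.2 hs)]
      linear_combination (-(r * radius T₁ w A B θ t * w t * cos (θ t))) * sin_sq_add_cos_sq (θ t)
  · have hR0 := mul_nonneg hr (radius_pos T₁ w A B θ t).le
    convert! ((hR t).mul (h.2 t ht).cos).const_mul r using 1
    rw [angleRhsDeriv, angleRhs, ← mul_assoc]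
    rcases le_total (sin (θ t)) 0 with hs | hs
    · rw [max_eq_right hs, max_eq_left (neg_nonneg.2 hs),
        max_eq_right (mul_nonpos_of_nonneg_of_nonpos hR0 hs),
        max_eq_left (neg_nonneg.2 (mul_nonpos_of_nonneg_of_nonpos hR0 hs))]
      linear_combination (r * radius T₁ w A B θ t * B t * sin (θ t)) * sin_sq_add_cos_sq (θ t)
    · rw [max_eq_left hs, max_eq_right (neg_nonpos.2 hs), max_eq_left (mul_nonneg hR0 hs),
        max_eq_right (neg_nonpos.2 (mul_nonneg hR0 hs))]
      linear_combination (r * radius T₁ w A B θ t * A t * sin (θ t)) * sin_sq_add_cos_sq (θ t)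

namespace Coeffs

variable {D : Coeffs} {θ₀ : ℝ} {x : ℝ × ℝ}

/-- Being a solution of the asymmetric Neumann problem with the coefficients `D`. -/
def IsSol (D : Coeffs) (x : ℝ × ℝ) (u : ℝ → ℝ) : Prop :=
  IsFucikSolution D.T₁ D.T₂ D.p D.q D.m D.n x.1 x.2 u

theorem isSol_of_angle (h1 : cos θ₀ = 0) (h2 : cos (D.angle θ₀ x D.T₂) = 0) :
    ∃ r : ℝ → ℝ, (∀ t, 0 < r t) ∧ D.IsSol x fun t => r t * sin (D.angle θ₀ x t) := by
  have ha := D.isAngle θ₀ x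
  have hs := ha.isSystemSolution D.w_cont (D.A_cont x) (D.B_cont x) zero_le_one
  simp only [one_mul] at hs
  have hθ := ha.1
  have hR := hasDerivAt_radius D.w_cont (D.A_cont x) (D.B_cont x) hθ D.T₁
  set r := radius D.T₁ D.w (D.A x) (D.B x) (D.angle θ₀ x) with hr
  have hr0 : ∀ t, 0 < r t := radius_pos D.T₁ D.w (D.A x) (D.B x) (D.angle θ₀ x)
  have hRc : Continuous r := continuous_iff_continuousAt.2 fun t => (hR t).continuousAt
  have hw := D.w_cont
  have hc : Continuous fun t => D.w t * (r t * cos (D.angle θ₀ x t)) := by fun_prop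
  refine ⟨r, hr0, fun t => D.w t * (r t * cos (D.angle θ₀ x t)), hc.continuousOn,
    fun t ht => hasDerivWithinAt_Icc_of_Ioo hs.contU hc hs.derivU ht, fun t ht => ?_, ?_, ?_⟩
  · have e : (fun s => D.p s * (D.w s * (r s * cos (D.angle θ₀ x s)))) =
        fun s => r s * cos (D.angle θ₀ x s) := by
      funext s
      rw [← mul_assoc, w, mul_inv_cancel₀ (D.p_pos s).ne', one_mul]
    rw [e]
    convert! hs.derivV t ht using 1
    simp only [A, B]
    rcases le_total (r t * sin (D.angle θ₀ x t)) 0 with hs | hs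
    · rw [max_eq_right hs, max_eq_left (neg_nonneg.2 hs)]
      ring
    · rw [max_eq_left hs, max_eq_right (neg_nonpos.2 hs)]
      ring
  · simp [D.angle_left, h1]
  · simp [h2]

/-- The initial data `(u T₁, 0)` are `|u T₁|` times those of an angle starting at `±π / 2`;
uniqueness for the system then identifies the solutions. -/
theorem exists_angle_of_isSol {u : ℝ → ℝ} (hu : D.IsSol x u)
    (hne : ∃ t ∈ Icc D.T₁ D.T₂, u t ≠ 0) :
    ContinuousOn u (Icc D.T₁ D.T₂) ∧ ∃ θ₀, IsStart θ₀ ∧ cos (D.angle θ₀ x D.T₂) = 0 ∧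
      ∃ r : ℝ → ℝ, (∀ t, 0 < r t) ∧ ∀ t ∈ Icc D.T₁ D.T₂, u t = r t * sin (D.angle θ₀ x t) := by
  obtain ⟨u', hc, hd, hv, h1, h2⟩ := hu
  have hcu : ContinuousOn u (Icc D.T₁ D.T₂) := fun t ht => (hd t ht).continuousWithinAt
  have hp := D.p_cont
  have hsys : IsSystemSolution D.T₁ D.T₂ D.w (D.A x) (D.B x) u (fun t => D.p t * u' t) := by
    refine ⟨hcu, hp.continuousOn.mul hc, fun t ht => ?_, fun t ht => ?_⟩
    · rw [w, inv_mul_cancel_left₀ (D.p_pos t).ne']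
      exact (hd t (Ioo_subset_Icc_self ht)).hasDerivAt (Icc_mem_nhds ht.1 ht.2)
    · convert! hv t ht using 1
      simp only [A, B]
      rcases le_total (u t) 0 with hs | hs
      · rw [max_eq_right hs, max_eq_left (neg_nonneg.2 hs)]
        ring
      · rw [max_eq_left hs, max_eq_right (neg_nonpos.2 hs)]
        ring
  have hT := right_mem_Icc.2 D.lt.le
  have key : ∀ θ₀, IsStart θ₀ → u D.T₁ = |u D.T₁| * sin θ₀ → ∀ t ∈ Icc D.T₁ D.T₂,
      u t = |u D.T₁| * (radius D.T₁ D.w (D.A x) (D.B x) (D.angle θ₀ x) t *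
        sin (D.angle θ₀ x t)) ∧ D.p t * u' t = |u D.T₁| *
        (radius D.T₁ D.w (D.A x) (D.B x) (D.angle θ₀ x) t * cos (D.angle θ₀ x t)) := by
    intro θ₀ hθ₀ hstart t ht
    refine hsys.unique ((D.isAngle θ₀ x).isSystemSolution D.w_cont (D.A_cont x) (D.B_cont x)
      (abs_nonneg _)) D.w_cont (D.A_cont x) (D.B_cont x) ?_ ?_ ht
    · rw [radius_left, one_mul, D.angle_left, ← hstart]
    · rw [h1, D.angle_left, hθ₀.cos_eq_zero]
      ring
  -- If `u` vanished at `T₁`, the scaling factor would be `0` and `u` would vanish identically.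
  have hne1 : u D.T₁ ≠ 0 := by
    intro h0
    obtain ⟨t, ht, hut⟩ := hne
    refine hut ?_
    rw [(key (π / 2) (Or.inl rfl) (by simp [h0]) t ht).1, h0, abs_zero, zero_mul]
  have hpos : 0 < |u D.T₁| := abs_pos.2 hne1
  have fin : ∀ θ₀, IsStart θ₀ → u D.T₁ = |u D.T₁| * sin θ₀ →
      ∃ θ₀, IsStart θ₀ ∧ cos (D.angle θ₀ x D.T₂) = 0 ∧
      ∃ r : ℝ → ℝ, (∀ t, 0 < r t) ∧ ∀ t ∈ Icc D.T₁ D.T₂, u t = r t * sin (D.angle θ₀ x t) := by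
    intro θ₀ hθ₀ hstart
    refine ⟨θ₀, hθ₀, ?_, fun t => |u D.T₁| * radius D.T₁ D.w (D.A x) (D.B x) (D.angle θ₀ x) t,
      fun t => mul_pos hpos (radius_pos _ _ _ _ _ _), fun t ht => ?_⟩
    · have := (key θ₀ hθ₀ hstart _ hT).2
      rw [h2, mul_zero] at this
      have hr := radius_pos D.T₁ D.w (D.A x) (D.B x) (D.angle θ₀ x) D.T₂
      rcases mul_eq_zero.1 this.symm with e | e
      · exact absurd e hpos.ne'
      · exact (mul_eq_zero.1 e).resolve_left hr.ne'
    · rw [(key θ₀ hθ₀ hstart t ht).1, mul_assoc]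
  refine ⟨hcu, ?_⟩
  rcases lt_or_gt_of_ne hne1 with hneg | hp0
  · exact fin (-(π / 2)) (Or.inr rfl) (by rw [abs_of_neg hneg]; simp)
  · exact fin (π / 2) (Or.inl rfl) (by rw [abs_of_pos hp0]; simp)

theorem encard_zeros_eq {u r : ℝ → ℝ} (hr : ∀ t, 0 < r t)
    (hu : ∀ t ∈ Icc D.T₁ D.T₂, u t = r t * sin (D.angle θ₀ x t)) (h1 : cos θ₀ = 0) {j : ℕ}
    (hj : D.angle θ₀ x D.T₂ = θ₀ + j * π) : {t | t ∈ Ioo D.T₁ D.T₂ ∧ u t = 0}.encard = j := by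
  rw [← (D.isAngle θ₀ x).encard_zeros D.w_cont (D.A_cont x) (D.B_cont x) D.w_pos D.lt
    (by rwa [D.angle_left]) (by rwa [D.angle_left])]
  congr 1
  ext t
  refine and_congr_right fun ht => ?_
  rw [hu t (Ioo_subset_Icc_self ht), mul_eq_zero]
  exact or_iff_right (hr t).ne'

theorem exists_nat_angle (h1 : cos θ₀ = 0) (h2 : cos (D.angle θ₀ x D.T₂) = 0) :
    ∃ j : ℕ, D.angle θ₀ x D.T₂ = θ₀ + j * π := by
  have := (D.isAngle θ₀ x).exists_nat D.w_cont (D.A_cont x) (D.B_cont x) D.w_pos D.lt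
    (by rwa [D.angle_left]) h2
  rwa [D.angle_left] at this

/-- Solutions with `k` zeros and a prescribed final sign `σ`, in terms of the angle. -/
theorem exists_isSol_iff (D : Coeffs) (x : ℝ × ℝ) (k : ℕ) {σ : ℝ} (hσ : σ = 1 ∨ σ = -1) :
    (∃ u, D.IsSol x u ∧ {t | t ∈ Ioo D.T₁ D.T₂ ∧ u t = 0}.encard = k ∧ 0 < σ * u D.T₂) ↔
      D.angle (σ * (-1) ^ k * (π / 2)) x D.T₂ = σ * (-1) ^ k * (π / 2) + k * π := by
  have hT := right_mem_Icc.2 D.lt.le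
  have hk : ((-1 : ℝ) ^ k) = 1 ∨ ((-1 : ℝ) ^ k) = -1 := neg_one_pow_eq_or ℝ k
  constructor
  · rintro ⟨u, hu, hcard, hpos⟩
    obtain ⟨-, θ₀, hθ₀, h2, r, hr, hur⟩ := exists_angle_of_isSol hu
      ⟨D.T₂, hT, fun h => by simp [h] at hpos⟩
    obtain ⟨j, hj⟩ := exists_nat_angle hθ₀.cos_eq_zero h2
    have hjk : j = k := by
      have := encard_zeros_eq hr hur hθ₀.cos_eq_zero hj
      rw [hcard] at this
      exact_mod_cast this.symm
    subst hjk
    -- The final sign is `(-1) ^ j` times the sign of `sin θ₀`, and this singles out one of the two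
    -- starts.
    rw [hur _ hT, hj, sin_add_nat_mul_pi, mul_left_comm] at hpos
    have hpos' := pos_of_mul_pos_right hpos (hr _).le
    have e : θ₀ = σ * (-1) ^ j * (π / 2) := by
      rcases hθ₀ with rfl | rfl <;> rcases hσ with rfl | rfl <;> rcases hk with e | e <;>
        rw [e] at hpos' ⊢ <;> first | ring1 | (norm_num at hpos')
    rw [← e]
    exact hj
  · intro h
    have hs : IsStart (σ * (-1) ^ k * (π / 2)) := by
      rcases hσ with rfl | rfl <;> rcases hk with e | e <;> rw [e] <;>
        first | (left; ring1) | (right; ring1)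
    obtain ⟨r, hr, hu⟩ := isSol_of_angle (D := D) (x := x) hs.cos_eq_zero
      (by rw [h, cos_add_nat_mul_pi, hs.cos_eq_zero, mul_zero])
    refine ⟨_, hu, encard_zeros_eq hr (fun _ _ => rfl) hs.cos_eq_zero h, ?_⟩
    rw [h, sin_add_nat_mul_pi, mul_left_comm]
    refine mul_pos (hr _) ?_
    rcases hσ with rfl | rfl <;> rcases hk with e | e <;> rw [e] <;> norm_num

theorem cGt_eq (D : Coeffs) (k : ℕ) : CGt D.T₁ D.T₂ D.p D.q D.m D.n k =
    {x | D.angle ((-1) ^ k * (π / 2)) x D.T₂ = (-1) ^ k * (π / 2) + k * π} := by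
  ext x
  have := D.exists_isSol_iff x k (σ := 1) (Or.inl rfl)
  simp only [one_mul] at this
  exact this

theorem cLt_eq (D : Coeffs) (k : ℕ) : CLt D.T₁ D.T₂ D.p D.q D.m D.n k =
    {x | D.angle (-1 * (-1) ^ k * (π / 2)) x D.T₂ = -1 * (-1) ^ k * (π / 2) + k * π} := by
  ext x
  rw [mem_ofPred_eq, ← D.exists_isSol_iff x k (σ := -1) (Or.inr rfl)]
  simp only [neg_one_mul, Left.neg_pos_iff]
  rfl

/-- With one weight for both signs the problem is linear. Positivity means that there is no zero
inside, so the angle makes no net advance, and the start is `π / 2`. -/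
theorem isPrincipalEigenvalue_iff (D : Coeffs) (l : ℝ) :
    IsPrincipalEigenvalue D.T₁ D.T₂ D.p D.q D.m l ↔
      D.diag.angle (π / 2) (l, l) D.T₂ = π / 2 := by
  have hg : ∀ u : ℝ → ℝ, (fun t => l * D.m t * max (u t) 0 - l * D.m t * max (-u t) 0) =
      fun t => l * D.m t * u t := fun u => by
    funext t
    rcases le_total (u t) 0 with hs | hs
    · rw [max_eq_right hs, max_eq_left (neg_nonneg.2 hs)]
      ring
    · rw [max_eq_left hs, max_eq_right (neg_nonpos.2 hs)]
      ring
  have hsol : ∀ u, D.diag.IsSol (l, l) u ↔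
      IsNeumannSolution D.T₁ D.T₂ D.p D.q (fun t => l * D.m t * u t) u := fun u => by
    rw [← hg u]
    rfl
  have hlt := D.lt
  have hpi := pi_pos
  constructor
  · rintro ⟨u, hu, hpos⟩
    have hmid : (D.T₁ + D.T₂) / 2 ∈ Ioo D.T₁ D.T₂ := ⟨by linarith, by linarith⟩
    obtain ⟨hcu, θ₀, hθ₀, h2, r, hr, hur⟩ := exists_angle_of_isSol ((hsol u).2 hu)
      ⟨_, Ioo_subset_Icc_self hmid, (hpos _ hmid).ne'⟩
    obtain ⟨j, hj⟩ := exists_nat_angle hθ₀.cos_eq_zero h2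
    have hj0 : j = 0 := by
      have := encard_zeros_eq hr hur hθ₀.cos_eq_zero hj
      rw [show {t | t ∈ Ioo D.diag.T₁ D.diag.T₂ ∧ u t = 0} = ∅ from
        eq_empty_of_forall_notMem fun t ht => (hpos t ht.1).ne' ht.2, encard_empty] at this
      exact_mod_cast this.symm
    have hu1 : 0 ≤ u D.T₁ := by
      refine le_on_closure (s := Ioo D.T₁ D.T₂) (f := fun _ => 0) (g := u)
        (fun t ht => (hpos t ht).le) continuousOn_const ?_ ?_ <;> rw [closure_Ioo hlt.ne]
      · exact hcu
      · exact left_mem_Icc.2 hlt.le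
    rcases hθ₀ with rfl | rfl
    · rw [hj0, Nat.cast_zero, zero_mul, add_zero] at hj
      exact hj
    · have e := hur D.T₁ (left_mem_Icc.2 hlt.le)
      rw [show D.diag.angle (-(π / 2)) (l, l) D.T₁ = -(π / 2) from D.diag.angle_left _ _,
        sin_neg, sin_pi_div_two] at e
      have := hr D.T₁
      linarith
  · intro h
    obtain ⟨r, hr, hu⟩ := isSol_of_angle (D := D.diag) (x := (l, l)) cos_pi_div_two
      (by
        change cos (D.diag.angle (π / 2) (l, l) D.T₂) = 0
        rw [h, cos_pi_div_two])
    refine ⟨_, (hsol _).1 hu, fun t ht => mul_pos (hr t) (sin_pos_of_pos_of_lt_pi ?_ ?_)⟩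
    · refine (D.diag.isAngle (π / 2) (l, l)).lt_of_sin_eq_zero D.w_cont (D.A_cont _)
        (D.diag.B_cont _) D.w_pos sin_zero le_rfl ht.1 ht.2.le ?_
      rw [D.diag.angle_left]
      linarith
    · by_contra! hge
      have := (D.diag.isAngle (π / 2) (l, l)).lt_of_sin_eq_zero D.w_cont (D.A_cont _)
        (D.diag.B_cont _) D.w_pos sin_pi ht.1.le ht.2 le_rfl hge
      rw [h] at this
      linarith

end Coeffs
end Fucik

/-! ### Principal eigenvalues and the first quadrant. -/

namespace Fucik
open Set Filter Topology Real

namespace Coeffs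

variable {D : Coeffs} {θ₀ : ℝ} {x : ℝ × ℝ}

/-- On a positive hump the angle obeys the linear equation with the first weight. -/
theorem hump_compare {ψ : ℝ → ℝ} (hψ : IsAngle D.T₁ D.T₂ D.w (D.A x) (D.A x) ψ) {s e : ℝ}
    (hs : D.T₁ ≤ s) (hse : s ≤ e) (he : e ≤ D.T₂) (h0 : 0 ≤ D.angle θ₀ x s)
    (hpi : D.angle θ₀ x e ≤ π) :
    (D.angle θ₀ x s ≤ ψ s → D.angle θ₀ x e ≤ ψ e) ∧
      (D.angle θ₀ x s < ψ s → D.angle θ₀ x e < ψ e) := by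
  have ha := D.isAngle θ₀ x
  have hsin : ∀ t ∈ Ioo s e, 0 ≤ sin (D.angle θ₀ x t) := by
    intro t ht
    refine sin_nonneg_of_nonneg_of_le_pi ?_ ?_
    · exact ha.le_of_sin_eq_zero D.w_cont (D.A_cont x) (D.B_cont x) D.w_pos sin_zero hs ht.1.le
        (ht.2.le.trans he) h0
    · by_contra! hgt
      exact hpi.not_gt (ha.lt_of_sin_eq_zero D.w_cont (D.A_cont x) (D.B_cont x) D.w_pos sin_pi
        (hs.trans ht.1.le) ht.2 he hgt.le)
  have hlin : IsAngle s e D.w (D.A x) (D.A x) (D.angle θ₀ x) :=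
    ⟨ha.1, fun t ht => by
      rw [angleRhs_of_sin_nonneg (B' := D.B x) (hsin t ht)]
      exact ha.2 t ⟨hs.trans_lt ht.1, ht.2.trans_le he⟩⟩
  exact hlin.compare (hψ.mono hs he) D.w_cont (D.A_cont x) (D.A_cont x) hse

/-- The linear angle from `π / 2` stays ahead of the asymmetric one along a positive hump. If that
hump ends at a zero, the linear angle has passed `π` and cannot return. If not, then `θ₀ = -π / 2`
and `k = 1`: the hump begins at an interior zero, where the linear angle is strictly ahead, and
stays so up to the final value `π / 2`. -/
theorem pi_div_two_lt_diag_angle (hθ₀ : IsStart θ₀) {k : ℕ} (hk : 1 ≤ k)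
    (hx : D.angle θ₀ x D.T₂ = θ₀ + k * π) :
    π / 2 < D.diag.angle (π / 2) (x.1, x.1) D.T₂ := by
  have hpi := pi_pos
  have hT := D.lt
  have hk' : (1 : ℝ) ≤ k := by exact_mod_cast hk
  have ha := D.isAngle θ₀ x
  have hψ : IsAngle D.T₁ D.T₂ D.w (D.A x) (D.A x) (D.diag.angle (π / 2) (x.1, x.1)) :=
    D.diag.isAngle (π / 2) (x.1, x.1)
  have hψ1 : D.diag.angle (π / 2) (x.1, x.1) D.T₁ = π / 2 := D.diag.angle_left _ _
  have hleft := D.angle_left θ₀ x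
  have hfin : ∀ e, D.T₁ ≤ e → e ≤ D.T₂ → π ≤ D.diag.angle (π / 2) (x.1, x.1) e →
      π / 2 < D.diag.angle (π / 2) (x.1, x.1) D.T₂ := fun e h1 h2 h3 => by
    have := hψ.le_of_sin_eq_zero D.w_cont (D.A_cont x) (D.A_cont x) D.w_pos sin_pi h1 h2 le_rfl h3
    linarith
  rcases hθ₀ with rfl | rfl
  · obtain ⟨z, hz, e⟩ := intermediate_value_Icc (f := D.angle (π / 2) x) hT.le
      ha.1.continuousOn (show π ∈ Icc _ _ from ⟨by linarith, by rw [hx]; nlinarith⟩)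
    refine hfin z hz.1 hz.2 ?_
    have := (hump_compare hψ le_rfl hz.1 hz.2 (by linarith) e.le).1 (by rw [hleft, hψ1])
    linarith
  · obtain ⟨z, hz, e⟩ := intermediate_value_Icc (f := D.angle (-(π / 2)) x) hT.le
      ha.1.continuousOn (show 0 ∈ Icc _ _ from ⟨by linarith, by rw [hx]; nlinarith⟩)
    have hz1 : D.T₁ < z := by
      refine lt_of_le_of_ne hz.1 ?_
      rintro rfl
      linarith
    have hψz : 0 < D.diag.angle (π / 2) (x.1, x.1) z :=
      hψ.lt_of_sin_eq_zero D.w_cont (D.A_cont x) (D.A_cont x) D.w_pos sin_zero le_rfl hz1 hz.2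
        (by linarith)
    rcases hk.eq_or_lt with rfl | hk2
    · have hx' : D.angle (-(π / 2)) x D.T₂ = π / 2 := by
        rw [hx]
        push_cast
        ring
      have := (hump_compare hψ hz.1 hz.2 le_rfl e.ge (by linarith)).2 (by linarith)
      linarith
    · have hk2' : (2 : ℝ) ≤ k := by exact_mod_cast hk2
      obtain ⟨z', hz', e'⟩ := intermediate_value_Icc (f := D.angle (-(π / 2)) x) hz.2
        ha.1.continuousOn (show π ∈ Icc _ _ from ⟨by linarith, by rw [hx]; nlinarith⟩)
      refine hfin z' (hz.1.trans hz'.1) hz'.2 ?_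
      have := (hump_compare hψ hz.1 hz'.1 hz'.2 e.ge e'.le).1 (by linarith)
      linarith

/-- If `m ≤ 0` throughout, the integral in the quotient would be nonpositive, against the energy
identity. -/
theorem exists_weight_pos (hθ₀ : IsStart θ₀) {k : ℕ} (hk : 1 ≤ k)
    (hx : D.angle θ₀ x D.T₂ = θ₀ + k * π) (hx1 : 0 < x.1) :
    ∃ t ∈ Icc D.T₁ D.T₂, 0 < D.m t := by
  by_contra! h
  have hq := pos_of_mul_pos_right (mul_quotient_posWeight_pos hθ₀ hk hx) hx1.le
  rw [quotient] at hq
  have hI := pos_of_mul_pos_right hq (exp_pos _).le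
  refine hI.not_ge (neg_nonneg.1 ?_)
  rw [← intervalIntegral.integral_neg]
  refine intervalIntegral.integral_nonneg D.lt.le fun t ht => neg_nonneg.2 ?_
  exact mul_nonpos_of_nonneg_of_nonpos (exp_pos _).le
    (mul_nonpos_of_nonpos_of_nonneg (h t ht) (sq_nonneg _))

/-- The nonnegative principal eigenvalues form the zero set of the continuous function `H - π / 2`.
It is nonempty because `H 0 ≤ π / 2`, and it is compact because nothing beyond `α` belongs to it. -/
theorem exists_isLambdaOne (hm : ∃ t ∈ Icc D.T₁ D.T₂, 0 < D.m t) {α : ℝ} (hα : 0 ≤ α)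
    (h : ∀ a, α < a → π / 2 < D.diag.angle (π / 2) (a, a) D.T₂) :
    ∃ l, IsLambdaOne D.T₁ D.T₂ D.p D.q D.m l ∧ l ≤ α := by
  set H : ℝ → ℝ := fun a => D.diag.angle (π / 2) (a, a) D.T₂ with hH
  have hc : Continuous H := (D.diag.angle_cont (π / 2)).comp
    (f := fun a : ℝ => ((a, a), D.T₂)) (by fun_prop)
  have h0 : H 0 ≤ π / 2 := by
    refine ((D.diag.isAngle (π / 2) (0, 0)).compare_const (c := π / 2) D.w_cont
      (D.diag.A_cont _) (D.diag.B_cont _) D.lt.le fun t _ => ?_).1 (D.diag.angle_left _ _).le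
    simp only [angleRhs, A, cos_pi_div_two, sin_pi_div_two]
    simpa using D.diag.q_nonneg t
  have hle : ∀ a, H a = π / 2 → a ≤ α := fun a ha => by
    by_contra! hlt
    exact (h a hlt).ne' ha
  have hset : {a | 0 ≤ a ∧ IsPrincipalEigenvalue D.T₁ D.T₂ D.p D.q D.m a} =
      Icc 0 α ∩ H ⁻¹' {π / 2} := by
    ext a
    simp only [mem_ofPred_eq, D.isPrincipalEigenvalue_iff, mem_inter_iff, mem_Icc, mem_preimage,
      mem_singleton_iff]
    exact ⟨fun ha => ⟨⟨ha.1, hle a ha.2⟩, ha.2⟩, fun ha => ⟨ha.1.1, ha.2⟩⟩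
  have hcomp : IsCompact (Icc 0 α ∩ H ⁻¹' {π / 2}) :=
    isCompact_Icc.inter_right (isClosed_singleton.preimage hc)
  have hne : (Icc 0 α ∩ H ⁻¹' {π / 2}).Nonempty := by
    obtain ⟨a, ha, e⟩ := intermediate_value_Icc (by linarith : (0 : ℝ) ≤ α + 1) hc.continuousOn
      ⟨h0, (h (α + 1) (by linarith)).le⟩
    exact ⟨a, ⟨ha.1, hle a e⟩, e⟩
  obtain ⟨l, hl⟩ := hcomp.exists_isGreatest hne
  exact ⟨l, ⟨hm, hset ▸ hl⟩, hl.1.1.2⟩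

theorem level_firstQuadrant (hθ₀ : IsStart θ₀) {k : ℕ} (hk : 1 ≤ k)
    (hne : ({x | D.angle θ₀ x D.T₂ = θ₀ + k * π} ∩ (Ici (0 : ℝ) ×ˢ Ici (0 : ℝ))).Nonempty) :
    ∃ lm ln α β : ℝ, ∃ f : ℝ → ℝ,
      IsLambdaOne D.T₁ D.T₂ D.p D.q D.m lm ∧ IsLambdaOne D.T₁ D.T₂ D.p D.q D.n ln ∧
      lm ≤ α ∧ ln ≤ β ∧ IsC1Diffeo f (Ioi α) (Ioi β) ∧ StrictAntiOn f (Ioi α) ∧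
      {x | D.angle θ₀ x D.T₂ = θ₀ + k * π} ∩ (Ici (0 : ℝ) ×ˢ Ici (0 : ℝ)) =
        (fun a => (a, f a)) '' Ioi α := by
  have hU := upwardLevel (D := D) hθ₀ hk
  obtain ⟨α, β, f, hf, hanti, himg⟩ := hU.exists_diffeo hne
  have hmem : ∀ a, α < a → D.angle θ₀ (a, f a) D.T₂ = θ₀ + k * π ∧ 0 ≤ a ∧ 0 ≤ f a := fun a ha => by
    have : (a, f a) ∈ (fun a => (a, f a)) '' Ioi α := ⟨a, ha, rfl⟩
    rw [← himg] at this
    exact this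
  have hα : 0 ≤ α := le_of_forall_gt_imp_ge_of_dense fun a ha => (hmem a ha).2.1
  obtain ⟨g, mg, -, inv⟩ := hf.2.2
  have hmem' : ∀ b, β < b → D.angle θ₀ (g b, b) D.T₂ = θ₀ + k * π ∧ 0 ≤ g b ∧ 0 ≤ b := fun b hb => by
    have h1 := hmem (g b) (mg hb)
    rwa [show f (g b) = b from inv.2 hb] at h1
  have hβ : 0 ≤ β := le_of_forall_gt_imp_ge_of_dense fun b hb => (hmem' b hb).2.2
  obtain ⟨c, hc, hs, hcos⟩ := exists_shift hθ₀
  have hsw : ∀ x : ℝ × ℝ, D.angle θ₀ x D.T₂ = θ₀ + k * π →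
      D.swap.angle (θ₀ + c) x.swap D.swap.T₂ = θ₀ + c + k * π := fun x hx => by
    have := D.angle_swap θ₀ x hs hcos (right_mem_Icc.2 D.lt.le)
    change D.swap.angle (θ₀ + c) x.swap D.T₂ = _
    rw [this, hx]
    ring
  obtain ⟨x, hx, hx1, hx2⟩ := hne
  have hpos := hU.pos_of_nonneg hx hx1 hx2
  obtain ⟨lm, hlm, hlmα⟩ := exists_isLambdaOne (D := D) (exists_weight_pos hθ₀ hk hx hpos.1) hα
    fun a ha => pi_div_two_lt_diag_angle hθ₀ hk (hmem a ha).1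
  -- The second weight is the first weight of the swapped problem, whose parameters on the same
  -- graph are `(b, g b)`.
  obtain ⟨ln, hln, hlnβ⟩ := exists_isLambdaOne (D := D.swap)
    (exists_weight_pos (x := x.swap) hc hk (hsw x hx) hpos.2) hβ
    fun b hb => pi_div_two_lt_diag_angle (D := D.swap) (x := (b, g b)) hc hk
      (hsw (g b, b) (hmem' b hb).1)
  exact ⟨lm, ln, α, β, f, hlm, hln, hlmα, hlnβ, hf, hanti, himg⟩

theorem firstQuadrant (D : Coeffs) {k : ℕ} (hk : 1 ≤ k) {C : Set (ℝ × ℝ)}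
    (hC : C = CGt D.T₁ D.T₂ D.p D.q D.m D.n k ∨ C = CLt D.T₁ D.T₂ D.p D.q D.m D.n k)
    (hne : (C ∩ (Ici (0 : ℝ) ×ˢ Ici (0 : ℝ))).Nonempty) :
    ∃ lm ln α β : ℝ, ∃ f : ℝ → ℝ,
      IsLambdaOne D.T₁ D.T₂ D.p D.q D.m lm ∧ IsLambdaOne D.T₁ D.T₂ D.p D.q D.n ln ∧
      lm ≤ α ∧ ln ≤ β ∧ IsC1Diffeo f (Ioi α) (Ioi β) ∧ StrictAntiOn f (Ioi α) ∧
      C ∩ (Ici (0 : ℝ) ×ˢ Ici (0 : ℝ)) = (fun a => (a, f a)) '' Ioi α := by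
  rw [D.cGt_eq, D.cLt_eq] at hC
  have h1 : IsStart ((-1) ^ k * (π / 2)) ∧ IsStart (-1 * (-1) ^ k * (π / 2)) := by
    rcases neg_one_pow_eq_or ℝ k with e | e <;> rw [e]
    · exact ⟨Or.inl (by ring), Or.inr (by ring)⟩
    · exact ⟨Or.inr (by ring), Or.inl (by ring)⟩
  rcases hC with rfl | rfl
  · exact level_firstQuadrant h1.1 hk hne
  · exact level_firstQuadrant h1.2 hk hne

end Coeffs

/-! ### Only the coefficients on `[T₁, T₂]` matter, so they may be extended by constants. -/

section Congruence

variable {T₁ T₂ : ℝ} {p q m n g p' q' m' n' g' : ℝ → ℝ}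

theorem IsNeumannSolution.congr {u : ℝ → ℝ} (h : IsNeumannSolution T₁ T₂ p q g u)
    (hp : EqOn p p' (Icc T₁ T₂)) (hq : EqOn q q' (Icc T₁ T₂)) (hg : EqOn g g' (Icc T₁ T₂)) :
    IsNeumannSolution T₁ T₂ p' q' g' u := by
  obtain ⟨u', hc, hd, hv, h1, h2⟩ := h
  refine ⟨u', hc, hd, fun t ht => ?_, h1, h2⟩
  have ht' := Ioo_subset_Icc_self ht
  rw [← hq ht', ← hg ht']
  refine (hv t ht).congr_of_eventuallyEq ?_
  filter_upwards [Icc_mem_nhds ht.1 ht.2] with s hs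
  rw [hp hs]

theorem IsFucikSolution.congr {a b : ℝ} {u : ℝ → ℝ} (h : IsFucikSolution T₁ T₂ p q m n a b u)
    (hp : EqOn p p' (Icc T₁ T₂)) (hq : EqOn q q' (Icc T₁ T₂)) (hm : EqOn m m' (Icc T₁ T₂))
    (hn : EqOn n n' (Icc T₁ T₂)) : IsFucikSolution T₁ T₂ p' q' m' n' a b u :=
  IsNeumannSolution.congr h hp hq fun t ht => by simp only [hm ht, hn ht]

theorem cGt_congr (hp : EqOn p p' (Icc T₁ T₂)) (hq : EqOn q q' (Icc T₁ T₂))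
    (hm : EqOn m m' (Icc T₁ T₂)) (hn : EqOn n n' (Icc T₁ T₂)) (k : ℕ) :
    CGt T₁ T₂ p q m n k = CGt T₁ T₂ p' q' m' n' k := by
  ext x
  exact exists_congr fun u => and_congr_left fun _ =>
    ⟨fun h => h.congr hp hq hm hn, fun h => h.congr hp.symm hq.symm hm.symm hn.symm⟩

theorem cLt_congr (hp : EqOn p p' (Icc T₁ T₂)) (hq : EqOn q q' (Icc T₁ T₂))
    (hm : EqOn m m' (Icc T₁ T₂)) (hn : EqOn n n' (Icc T₁ T₂)) (k : ℕ) :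
    CLt T₁ T₂ p q m n k = CLt T₁ T₂ p' q' m' n' k := by
  ext x
  exact exists_congr fun u => and_congr_left fun _ =>
    ⟨fun h => h.congr hp hq hm hn, fun h => h.congr hp.symm hq.symm hm.symm hn.symm⟩

theorem isLambdaOne_congr (hp : EqOn p p' (Icc T₁ T₂)) (hq : EqOn q q' (Icc T₁ T₂))
    (hm : EqOn m m' (Icc T₁ T₂)) (l : ℝ) :
    IsLambdaOne T₁ T₂ p q m l ↔ IsLambdaOne T₁ T₂ p' q' m' l := by
  have e : ∀ x, IsPrincipalEigenvalue T₁ T₂ p q m x ↔ IsPrincipalEigenvalue T₁ T₂ p' q' m' x :=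
    fun x => exists_congr fun u => and_congr_left fun _ =>
      ⟨fun h => h.congr hp hq fun t ht => by simp only [hm ht],
        fun h => h.congr hp.symm hq.symm fun t ht => by simp only [hm ht]⟩
  refine and_congr (exists_congr fun t => and_congr_right fun ht => by rw [hm ht]) ?_
  simp only [e]

/-- The first-quadrant case for coefficients that are continuous on `[T₁, T₂]`. -/
theorem firstQuadrant (hT : T₁ < T₂) (hp : ContinuousOn p (Icc T₁ T₂))
    (hq : ContinuousOn q (Icc T₁ T₂)) (hm : ContinuousOn m (Icc T₁ T₂))
    (hn : ContinuousOn n (Icc T₁ T₂)) (hp_pos : ∀ t ∈ Icc T₁ T₂, 0 < p t)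
    (hq_nonneg : ∀ t ∈ Icc T₁ T₂, 0 ≤ q t) {k : ℕ} (hk : 1 ≤ k) {C : Set (ℝ × ℝ)}
    (hC : C = CGt T₁ T₂ p q m n k ∨ C = CLt T₁ T₂ p q m n k)
    (hne : (C ∩ (Ici (0 : ℝ) ×ˢ Ici (0 : ℝ))).Nonempty) :
    ∃ lm ln α β : ℝ, ∃ f : ℝ → ℝ,
      IsLambdaOne T₁ T₂ p q m lm ∧ IsLambdaOne T₁ T₂ p q n ln ∧
      lm ≤ α ∧ ln ≤ β ∧ IsC1Diffeo f (Ioi α) (Ioi β) ∧ StrictAntiOn f (Ioi α) ∧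
      C ∩ (Ici (0 : ℝ) ×ˢ Ici (0 : ℝ)) = (fun a => (a, f a)) '' Ioi α := by
  have hext : ∀ h : ℝ → ℝ, EqOn h (fun t => h (projIcc T₁ T₂ hT.le t)) (Icc T₁ T₂) :=
    fun h t ht => by simp only [projIcc_of_mem hT.le ht]
  have hcont : ∀ h : ℝ → ℝ, ContinuousOn h (Icc T₁ T₂) →
      Continuous fun t => h (projIcc T₁ T₂ hT.le t) := fun h hh =>
    hh.comp_continuous (continuous_subtype_val.comp continuous_projIcc) fun t =>
      (projIcc T₁ T₂ hT.le t).2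
  rw [cGt_congr (hext p) (hext q) (hext m) (hext n),
    cLt_congr (hext p) (hext q) (hext m) (hext n)] at hC
  simp only [isLambdaOne_congr (hext p) (hext q) (hext m),
    isLambdaOne_congr (hext p) (hext q) (hext n)]
  exact Coeffs.firstQuadrant ⟨T₁, T₂, _, _, _, _, hT, hcont p hp, hcont q hq, hcont m hm,
    hcont n hn, fun t => hp_pos _ (projIcc T₁ T₂ hT.le t).2,
    fun t => hq_nonneg _ (projIcc T₁ T₂ hT.le t).2⟩ hk hC hne

end Congruence

/-! ### Reflection of the remaining quadrants to the first. -/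

section Reflection

variable {T₁ T₂ : ℝ} {p q m n : ℝ → ℝ}

/-- A sign of a parameter can be moved into its weight, because the equation contains only the
product. -/
theorem cGt_smul (σ τ : ℝ) (k : ℕ) :
    CGt T₁ T₂ p q (fun t => σ * m t) (fun t => τ * n t) k =
      {x | (x.1 * σ, x.2 * τ) ∈ CGt T₁ T₂ p q m n k} := by
  ext x
  simp only [CGt, IsFucikSolution, mem_ofPred_eq, mul_assoc]

theorem cLt_smul (σ τ : ℝ) (k : ℕ) :
    CLt T₁ T₂ p q (fun t => σ * m t) (fun t => τ * n t) k =
      {x | (x.1 * σ, x.2 * τ) ∈ CLt T₁ T₂ p q m n k} := by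
  ext x
  simp only [CLt, IsFucikSolution, mem_ofPred_eq, mul_assoc]

theorem IsLambdaOne.neg {l : ℝ} (h : IsLambdaOne T₁ T₂ p q (fun t => -1 * m t) l) :
    IsLambdaNegOne T₁ T₂ p q m (-l) := by
  have e : ∀ x, IsPrincipalEigenvalue T₁ T₂ p q (fun t => -1 * m t) x ↔
      IsPrincipalEigenvalue T₁ T₂ p q m (-x) := fun x => by
    simp only [IsPrincipalEigenvalue, neg_mul, one_mul, mul_neg]
  obtain ⟨⟨t, ht, hm⟩, ⟨h0, hl⟩, hub⟩ := h
  refine ⟨⟨t, ht, by linarith⟩, ⟨by simpa using h0, (e l).1 hl⟩, fun y hy => ?_⟩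
  have : -y ≤ l := hub ⟨by simpa using hy.1, (e (-y)).2 (by rw [neg_neg]; exact hy.2)⟩
  linarith

theorem neg_mem_Ioi {a α : ℝ} (h : a ∈ Iio (-α)) : -a ∈ Ioi α :=
  mem_Ioi.2 (lt_neg.1 (mem_Iio.1 h))

theorem IsC1Diffeo.comp_neg {f : ℝ → ℝ} {α : ℝ} {T : Set ℝ} (h : IsC1Diffeo f (Ioi α) T) :
    IsC1Diffeo (fun a => f (-a)) (Iio (-α)) T := by
  obtain ⟨hm, hf, g, hgm, hg, hi⟩ := h
  have hneg : MapsTo (fun a : ℝ => -a) (Iio (-α)) (Ioi α) := fun a ha => neg_mem_Ioi ha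
  refine ⟨fun a ha => hm (hneg ha), hf.comp contDiff_neg.contDiffOn hneg, fun b => -g b,
    fun b hb => mem_Iio.2 (neg_lt_neg (mem_Ioi.1 (hgm hb))), hg.neg, fun a ha => ?_, fun b hb => ?_⟩
  · simp only [hi.1 (hneg ha), neg_neg]
  · simp only [neg_neg, hi.2 hb]

theorem IsC1Diffeo.neg {f : ℝ → ℝ} {β : ℝ} {S : Set ℝ} (h : IsC1Diffeo f S (Ioi β)) :
    IsC1Diffeo (fun a => -f a) S (Iio (-β)) := by
  obtain ⟨hm, hf, g, hgm, hg, hi⟩ := h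
  have hneg : MapsTo (fun a : ℝ => -a) (Iio (-β)) (Ioi β) := fun a ha => neg_mem_Ioi ha
  refine ⟨fun a ha => mem_Iio.2 (neg_lt_neg (mem_Ioi.1 (hm ha))), hf.neg, fun b => g (-b), fun b hb => hgm (hneg hb),
    hg.comp contDiff_neg.contDiffOn hneg, fun a ha => ?_, fun b hb => ?_⟩
  · simp only [neg_neg, hi.1 ha]
  · simp only [hi.2 (hneg hb), neg_neg]

end Reflection
end Fucik

open Fucik in
theorem theorem1 (T₁ T₂ : ℝ) (hT : T₁ < T₂) (p q m n : ℝ → ℝ)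
    (hp : ContinuousOn p (Set.Icc T₁ T₂)) (hq : ContinuousOn q (Set.Icc T₁ T₂))
    (hm : ContinuousOn m (Set.Icc T₁ T₂)) (hn : ContinuousOn n (Set.Icc T₁ T₂))
    (hp_pos : ∀ t ∈ Set.Icc T₁ T₂, 0 < p t) (hq_nonneg : ∀ t ∈ Set.Icc T₁ T₂, 0 ≤ q t)
    (hm_ne : ∃ t ∈ Set.Icc T₁ T₂, m t ≠ 0) (hn_ne : ∃ t ∈ Set.Icc T₁ T₂, n t ≠ 0)
    (k : ℕ) (hk : 1 ≤ k) (C : Set (ℝ × ℝ))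
    (hC : C = Fucik.CGt T₁ T₂ p q m n k ∨ C = Fucik.CLt T₁ T₂ p q m n k) :
    ((C ∩ (Set.Ici 0 ×ˢ Set.Ici 0)).Nonempty →
      ∃ lm ln α β : ℝ, ∃ f : ℝ → ℝ,
        Fucik.IsLambdaOne T₁ T₂ p q m lm ∧ Fucik.IsLambdaOne T₁ T₂ p q n ln ∧
        lm ≤ α ∧ ln ≤ β ∧
        Fucik.IsC1Diffeo f (Set.Ioi α) (Set.Ioi β) ∧ StrictAntiOn f (Set.Ioi α) ∧
        C ∩ (Set.Ici 0 ×ˢ Set.Ici 0) = (fun a => (a, f a)) '' Set.Ioi α) ∧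
    ((C ∩ (Set.Iic 0 ×ˢ Set.Iic 0)).Nonempty →
      ∃ lm ln α β : ℝ, ∃ f : ℝ → ℝ,
        Fucik.IsLambdaNegOne T₁ T₂ p q m lm ∧ Fucik.IsLambdaNegOne T₁ T₂ p q n ln ∧
        α ≤ lm ∧ β ≤ ln ∧
        Fucik.IsC1Diffeo f (Set.Iio α) (Set.Iio β) ∧ StrictAntiOn f (Set.Iio α) ∧
        C ∩ (Set.Iic 0 ×ˢ Set.Iic 0) = (fun a => (a, f a)) '' Set.Iio α) ∧
    ((C ∩ (Set.Iic 0 ×ˢ Set.Ici 0)).Nonempty →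
      ∃ lm ln α β : ℝ, ∃ f : ℝ → ℝ,
        Fucik.IsLambdaNegOne T₁ T₂ p q m lm ∧ Fucik.IsLambdaOne T₁ T₂ p q n ln ∧
        α ≤ lm ∧ ln ≤ β ∧
        Fucik.IsC1Diffeo f (Set.Iio α) (Set.Ioi β) ∧ StrictMonoOn f (Set.Iio α) ∧
        C ∩ (Set.Iic 0 ×ˢ Set.Ici 0) = (fun a => (a, f a)) '' Set.Iio α) ∧
    ((C ∩ (Set.Ici 0 ×ˢ Set.Iic 0)).Nonempty →
      ∃ lm ln α β : ℝ, ∃ f : ℝ → ℝ,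
        Fucik.IsLambdaOne T₁ T₂ p q m lm ∧ Fucik.IsLambdaNegOne T₁ T₂ p q n ln ∧
        lm ≤ α ∧ β ≤ ln ∧
        Fucik.IsC1Diffeo f (Set.Ioi α) (Set.Iio β) ∧ StrictMonoOn f (Set.Ioi α) ∧
        C ∩ (Set.Ici 0 ×ˢ Set.Iic 0) = (fun a => (a, f a)) '' Set.Ioi α) := by
  -- `σ` and `τ` are the signs of the quadrant: the first-quadrant result is applied to the weights
  -- `σ m`, `τ n` and read back in the original parameters.
  have key : ∀ σ τ : ℝ, (∃ x ∈ C, 0 ≤ x.1 * σ ∧ 0 ≤ x.2 * τ) → σ * σ = 1 → τ * τ = 1 →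
      ∃ lm ln α β : ℝ, ∃ f : ℝ → ℝ,
        IsLambdaOne T₁ T₂ p q (fun t => σ * m t) lm ∧
        IsLambdaOne T₁ T₂ p q (fun t => τ * n t) ln ∧
        lm ≤ α ∧ ln ≤ β ∧ IsC1Diffeo f (Set.Ioi α) (Set.Ioi β) ∧ StrictAntiOn f (Set.Ioi α) ∧
        ∀ x : ℝ × ℝ, (x ∈ C ∧ 0 ≤ x.1 * σ ∧ 0 ≤ x.2 * τ) ↔ α < x.1 * σ ∧ f (x.1 * σ) = x.2 * τ := by
    intro σ τ ⟨x₀, hx₀, h1, h2⟩ hσ hτ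
    have hC' : {x : ℝ × ℝ | (x.1 * σ, x.2 * τ) ∈ C} =
        CGt T₁ T₂ p q (fun t => σ * m t) (fun t => τ * n t) k ∨
        {x : ℝ × ℝ | (x.1 * σ, x.2 * τ) ∈ C} =
        CLt T₁ T₂ p q (fun t => σ * m t) (fun t => τ * n t) k := by
      rw [cGt_smul, cLt_smul]
      rcases hC with rfl | rfl
      · exact Or.inl rfl
      · exact Or.inr rfl
    have hsq : ∀ x : ℝ × ℝ, (x.1 * σ * σ, x.2 * τ * τ) = x := fun x => by
      rw [mul_assoc, mul_assoc, hσ, hτ, mul_one, mul_one]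
    obtain ⟨lm, ln, α, β, f, a1, a2, a3, a4, a5, a6, a7⟩ := firstQuadrant hT hp hq
      (hm.const_mul σ) (hn.const_mul τ) hp_pos hq_nonneg hk hC'
      ⟨(x₀.1 * σ, x₀.2 * τ), by rw [Set.mem_ofPred_eq, hsq]; exact hx₀, h1, h2⟩
    refine ⟨lm, ln, α, β, f, a1, a2, a3, a4, a5, a6, fun x => ?_⟩
    have := Set.ext_iff.1 a7 (x.1 * σ, x.2 * τ)
    simp only [Set.mem_inter_iff, Set.mem_ofPred_eq, hsq, Set.mem_prod, Set.mem_Ici,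
      Set.mem_image, Set.mem_Ioi, Prod.mk.injEq] at this
    rw [this]
    constructor
    · rintro ⟨a, ha, rfl, e⟩
      exact ⟨ha, e⟩
    · rintro ⟨ha, e⟩
      exact ⟨_, ha, rfl, e⟩
  refine ⟨fun ⟨x, hx, h1, h2⟩ => ?_, fun ⟨x, hx, h1, h2⟩ => ?_, fun ⟨x, hx, h1, h2⟩ => ?_,
    fun ⟨x, hx, h1, h2⟩ => ?_⟩ <;> simp only [Set.mem_Ici, Set.mem_Iic] at h1 h2
  · exact firstQuadrant hT hp hq hm hn hp_pos hq_nonneg hk hC ⟨x, hx, h1, h2⟩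
  · obtain ⟨lm, ln, α, β, f, a1, a2, a3, a4, a5, a6, a7⟩ :=
      key (-1) (-1) ⟨x, hx, by linarith, by linarith⟩ (by norm_num) (by norm_num)
    -- Reflecting both coordinates keeps `f` decreasing; in the mixed quadrants below only one is
    -- reflected, which makes it increasing.
    refine ⟨-lm, -ln, -α, -β, fun a => -f (-a), a1.neg, a2.neg, neg_le_neg a3, neg_le_neg a4,
      a5.comp_neg.neg, fun a ha b hb hab => neg_lt_neg
        (a6 (neg_mem_Ioi hb) (neg_mem_Ioi ha) (neg_lt_neg hab)), ?_⟩
    ext ⟨a, b⟩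
    have := a7 (a, b)
    simp only [mul_neg, mul_one, Left.nonneg_neg_iff, lt_neg (a := α)] at this
    simp only [Set.mem_inter_iff, Set.mem_prod, Set.mem_Iic, Set.mem_image, Set.mem_Iio,
      Prod.mk.injEq, this, neg_eq_iff_eq_neg]
    grind
  · obtain ⟨lm, ln, α, β, f, a1, a2, a3, a4, a5, a6, a7⟩ :=
      key (-1) 1 ⟨x, hx, by linarith, by linarith⟩ (by norm_num) (by norm_num)
    simp only [one_mul] at a2
    refine ⟨-lm, ln, -α, β, fun a => f (-a), a1.neg, a2, neg_le_neg a3, a4,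
      a5.comp_neg, fun a ha b hb hab =>
        a6 (neg_mem_Ioi hb) (neg_mem_Ioi ha) (neg_lt_neg hab), ?_⟩
    ext ⟨a, b⟩
    have := a7 (a, b)
    simp only [mul_neg, mul_one, Left.nonneg_neg_iff, lt_neg (a := α)] at this
    simp only [Set.mem_inter_iff, Set.mem_prod, Set.mem_Iic, Set.mem_Ici, Set.mem_image,
      Set.mem_Iio, Prod.mk.injEq, this]
    grind
  · obtain ⟨lm, ln, α, β, f, a1, a2, a3, a4, a5, a6, a7⟩ :=
      key 1 (-1) ⟨x, hx, by linarith, by linarith⟩ (by norm_num) (by norm_num)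
    simp only [one_mul] at a1
    refine ⟨lm, -ln, α, -β, fun a => -f a, a1, a2.neg, a3, neg_le_neg a4,
      a5.neg, fun a ha b hb hab => neg_lt_neg (a6 ha hb hab), ?_⟩
    ext ⟨a, b⟩
    have := a7 (a, b)
    simp only [mul_neg, mul_one, Left.nonneg_neg_iff] at this
    simp only [Set.mem_inter_iff, Set.mem_prod, Set.mem_Iic, Set.mem_Ici, Set.mem_image,
      Set.mem_Ioi, Prod.mk.injEq, this]
    grind
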